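/- A $k$-partition ($k\ge 2$) of a rectangle $R$ in the Euclidean plane is a tiling of $R$ by $k$ rectangles, i.e. a set of $k$ rectangles with pairwise disjoint interiors and union $R$. Two rectangles are congruent if they have the same side lengths, not necessarily in the same order. A $k$-partition of $R$ is Mondrian if no two of its rectangles are congruent; a Mondrian partition is perfect if each of its rectangles has area $\frac1k\operatorname{area}(R)$; and a partition is proper if no $m$ of its rectangles with $1<m<k$ form a rectangle. Let $S$ be a square. Then, up to symmetries of $S$, there is exactly one proper perfect Mondrian $7$-partition of $S$: there is such a partition $\mathcal P$, and every proper perfect Mondrian $7$-partition of $S$ is the image of $\mathcal P$ under an isometry of the plane that maps $S$ onto itself. Moreover, $\mathcal P$ has the spiral pattern: after moving $S$ to $[0,\ell]\times[0,\ell]$ by an isometry, there are reals $0<x_1<x_2<x_3<\ell$ and $0<y_1<y_2<y_3<\ell$ such that $\mathcal P$ consists of $$[0,x_3]\times[y_3,\ell],\quad [x_3,\ell]\times[y_1,\ell],\quad [x_1,\ell]\times[0,y_1],\quad [0,x_1]\times[0,y_2],$$ $$[0,x_2]\times[y_2,y_3],\quad [x_2,x_3]\times[y_1,y_3],\quad [x_1,x_2]\times[y_1,y_2].$$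 -/

import Mathlib

open MeasureTheory Set

namespace Mondrian

/-- The Euclidean plane. -/
abbrev Plane : Type := EuclideanSpace ℝ (Fin 2)

/-- The closed box `[x₀, x₁] × [y₀, y₁]` in the plane. -/
def box (x₀ x₁ y₀ y₁ : ℝ) : Set Plane :=
  {p | p 0 ∈ Icc x₀ x₁ ∧ p 1 ∈ Icc y₀ y₁}

/-- `A` is a (closed, nondegenerate) rectangle, in any position in the plane, whose sides have
lengths `a` and `b`: the image of `[0, a] × [0, b]` under an isometry of the plane. The order
of `a` and `b` is irrelevant. -/
def HasSides (A : Set Plane) (a b : ℝ) : Prop :=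
  0 < a ∧ 0 < b ∧ ∃ f : Plane ≃ᵢ Plane, A = f '' box 0 a 0 b

/-- `A` is a rectangle. -/
def IsRectangle (A : Set Plane) : Prop := ∃ a b : ℝ, HasSides A a b

/-- `S` is a square. -/
def IsSquareSet (S : Set Plane) : Prop := ∃ a : ℝ, HasSides S a a

/-- Two rectangles are congruent if they have the same side lengths, in some order. -/
def Congruent (A B : Set Plane) : Prop := ∃ a b : ℝ, HasSides A a b ∧ HasSides B a b

/-- `P` is a `k`-partition of `R`: a tiling of `R` by `k ≥ 2` rectangles, that is, `k` rectangles
with pairwise disjoint interiors and union `R`. -/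
structure IsPartition (k : ℕ) (R : Set Plane) (P : Set (Set Plane)) : Prop where
  two_le : 2 ≤ k
  finite : P.Finite
  ncard_eq : P.ncard = k
  isRectangle : ∀ A ∈ P, IsRectangle A
  disjoint : P.Pairwise fun A B => Disjoint (interior A) (interior B)
  sUnion_eq : ⋃₀ P = R

/-- A partition is Mondrian if no two of its rectangles are congruent. -/
def IsMondrian (P : Set (Set Plane)) : Prop := P.Pairwise fun A B => ¬ Congruent A B

/-- All `k` rectangles have `1 / k` of the area of `R`. -/
def IsPerfect (k : ℕ) (R : Set Plane) (P : Set (Set Plane)) : Prop :=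
  ∀ A ∈ P, volume A = volume R / (k : ENNReal)

/-- A partition into `k` rectangles is proper if no `m` of its rectangles, with `1 < m < k`,
form a rectangle. -/
def IsProper (k : ℕ) (P : Set (Set Plane)) : Prop :=
  ∀ Q ⊆ P, 1 < Q.ncard → Q.ncard < k → ¬ IsRectangle (⋃₀ Q)

/-- `P` is a proper perfect Mondrian `k`-partition of `R`. -/
structure IsProperPerfectMondrian (k : ℕ) (R : Set Plane) (P : Set (Set Plane)) : Prop where
  isPartition : IsPartition k R P
  isMondrian : IsMondrian P
  isPerfect : IsPerfect k R P
  isProper : IsProper k P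

/-- The image of a collection of sets under an isometry of the plane. -/
def mapPartition (e : Plane ≃ᵢ Plane) (P : Set (Set Plane)) : Set (Set Plane) :=
  (fun A => e '' A) '' P

/-- The seven tiles of the spiral pattern in `[0, ℓ] × [0, ℓ]`, with vertical lines at
`x₁ < x₂ < x₃` and horizontal lines at `y₁ < y₂ < y₃`. In spiral order: top left, top right,
bottom right and bottom left corner, then the tile on the left side, then the two inner tiles. -/
def spiralTiles (ℓ x₁ x₂ x₃ y₁ y₂ y₃ : ℝ) : Set (Set Plane) :=
  {box 0 x₃ y₃ ℓ, box x₃ ℓ y₁ ℓ, box x₁ ℓ 0 y₁, box 0 x₁ 0 y₂,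
   box 0 x₂ y₂ y₃, box x₂ x₃ y₁ y₃, box x₁ x₂ y₁ y₂}

/-- `P` dissects the square `S` in the spiral pattern with seven tiles, up to the position of `S`
in the plane. -/
def IsSpiral (S : Set Plane) (P : Set (Set Plane)) : Prop :=
  ∃ (f : Plane ≃ᵢ Plane) (ℓ x₁ x₂ x₃ y₁ y₂ y₃ : ℝ),
    0 < x₁ ∧ x₁ < x₂ ∧ x₂ < x₃ ∧ x₃ < ℓ ∧ 0 < y₁ ∧ y₁ < y₂ ∧ y₂ < y₃ ∧ y₃ < ℓ ∧
    S = f '' box 0 ℓ 0 ℓ ∧ P = mapPartition f (spiralTiles ℓ x₁ x₂ x₃ y₁ y₂ y₃)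

end Mondrian

/-! The tiles of a square tiled by rectangles are parallel to its sides: an oblique tile with
extreme corner would have a neighbour that overlaps it (`IsPartition.axis_zero`). So a partition
becomes an `EquiTiling`, a list of coordinates.

Properness forbids a straight cut across the square and two tiles that form a rectangle. Hence the
shallowest tile on a side of the square has neighbours that reach deeper, and the valley between
them starts with at least two tiles (`valley_top`). If the narrowest tile on a side were not in a
corner, then this tile, two tiles of its valley and the four corner tiles would be all seven, and
equal areas would give contradictory inequalities between heights (`narrowest_left_in_corner`). So
each side has its extreme tile in a corner. By the valley again, no corner tile is extreme on both
of its sides; up to a reflection the extreme tiles therefore turn around the square as an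
`IsPinwheel`. If no further tile touched the boundary, the four corner tiles would enclose a
rectangle made of the other three (`IsPinwheel.exists_middle`). So there is a fifth boundary tile,
and the valleys then fix all adjacencies (`IsPinwheel.range_tile_eq`): the tiling is a spiral.

For a spiral the area equations have at most one solution: enlarging `x₁` shifts the other lines in
turn, until the last inner tile would have to be both taller and shorter (`SpiralCoords.not_x₁_lt`).
The solution exists and has coordinates in ℚ(√19)·ℓ. Its tiles have different diameters, so none are
congruent. It is proper because a rectangular union is convex: a tile whose interior contains the
midpoint of two points of the union belongs to the union, and in this way any two tiles generate all
seven (`SpiralBounds.isProper`). -/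

namespace Mondrian

/-! ### Tilings in coordinates and the symmetries of the square -/

/-- Coordinates of a proper tiling of `[0, ℓ] × [0, ℓ]` by seven axis-parallel boxes of equal area
and pairwise different widths. The four fields `ne`, `nw`, `se`, `sw` say that each point has a
tile covering its germ in the given quadrant. -/
structure EquiTiling (ι : Type) (ℓ : ℝ) where
  x₀ : ι → ℝ
  x₁ : ι → ℝ
  y₀ : ι → ℝ
  y₁ : ι → ℝ
  pos : 0 < ℓ
  card : Nat.card ι = 7
  hx : ∀ i, x₀ i < x₁ i
  hy : ∀ i, y₀ i < y₁ i
  x₀_nonneg : ∀ i, 0 ≤ x₀ i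
  x₁_le : ∀ i, x₁ i ≤ ℓ
  y₀_nonneg : ∀ i, 0 ≤ y₀ i
  y₁_le : ∀ i, y₁ i ≤ ℓ
  ne : ∀ x y, 0 ≤ x → x < ℓ → 0 ≤ y → y < ℓ → ∃ i, x₀ i ≤ x ∧ x < x₁ i ∧ y₀ i ≤ y ∧ y < y₁ i
  nw : ∀ x y, 0 < x → x ≤ ℓ → 0 ≤ y → y < ℓ → ∃ i, x₀ i < x ∧ x ≤ x₁ i ∧ y₀ i ≤ y ∧ y < y₁ i
  se : ∀ x y, 0 ≤ x → x < ℓ → 0 < y → y ≤ ℓ → ∃ i, x₀ i ≤ x ∧ x < x₁ i ∧ y₀ i < y ∧ y ≤ y₁ i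
  sw : ∀ x y, 0 < x → x ≤ ℓ → 0 < y → y ≤ ℓ → ∃ i, x₀ i < x ∧ x ≤ x₁ i ∧ y₀ i < y ∧ y ≤ y₁ i
  disj : ∀ i j, i ≠ j → x₁ i ≤ x₀ j ∨ x₁ j ≤ x₀ i ∨ y₁ i ≤ y₀ j ∨ y₁ j ≤ y₀ i
  area : ∀ i, (x₁ i - x₀ i) * (y₁ i - y₀ i) = ℓ ^ 2 / 7
  -- As all areas agree, equal widths mean equal heights. Only this case of congruence, without a
  -- quarter turn, is needed for the classification.
  width_inj : ∀ i j, x₁ i - x₀ i = x₁ j - x₀ j → i = j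
  -- A box that cuts through no tile and contains two tiles contains all of them.
  proper : ∀ u₀ u₁ v₀ v₁, u₀ < u₁ → v₀ < v₁ → 0 ≤ u₀ → u₁ ≤ ℓ → 0 ≤ v₀ → v₁ ≤ ℓ →
    (∀ i, (u₀ ≤ x₀ i ∧ x₁ i ≤ u₁ ∧ v₀ ≤ y₀ i ∧ y₁ i ≤ v₁) ∨
      x₁ i ≤ u₀ ∨ u₁ ≤ x₀ i ∨ y₁ i ≤ v₀ ∨ v₁ ≤ y₀ i) →
    ∀ i j, i ≠ j → (u₀ ≤ x₀ i ∧ x₁ i ≤ u₁ ∧ v₀ ≤ y₀ i ∧ y₁ i ≤ v₁) →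
      (u₀ ≤ x₀ j ∧ x₁ j ≤ u₁ ∧ v₀ ≤ y₀ j ∧ y₁ j ≤ v₁) →
      ∀ k, u₀ ≤ x₀ k ∧ x₁ k ≤ u₁ ∧ v₀ ≤ y₀ k ∧ y₁ k ≤ v₁

namespace EquiTiling

variable {ι : Type} {ℓ : ℝ}

/-- The mirror image under `(x, y) ↦ (ℓ - x, y)`. -/
@[simps] def flipX (τ : EquiTiling ι ℓ) : EquiTiling ι ℓ where
  x₀ i := ℓ - τ.x₁ i
  x₁ i := ℓ - τ.x₀ i
  y₀ := τ.y₀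
  y₁ := τ.y₁
  pos := τ.pos
  card := τ.card
  hx i := by linarith [τ.hx i]
  hy := τ.hy
  x₀_nonneg i := by linarith [τ.x₁_le i]
  x₁_le i := by linarith [τ.x₀_nonneg i]
  y₀_nonneg := τ.y₀_nonneg
  y₁_le := τ.y₁_le
  ne x y h1 h2 h3 h4 := by
    obtain ⟨i, a, b, c, d⟩ := τ.nw (ℓ - x) y (by linarith) (by linarith) h3 h4
    exact ⟨i, by linarith, by linarith, c, d⟩
  nw x y h1 h2 h3 h4 := by
    obtain ⟨i, a, b, c, d⟩ := τ.ne (ℓ - x) y (by linarith) (by linarith) h3 h4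
    exact ⟨i, by linarith, by linarith, c, d⟩
  se x y h1 h2 h3 h4 := by
    obtain ⟨i, a, b, c, d⟩ := τ.sw (ℓ - x) y (by linarith) (by linarith) h3 h4
    exact ⟨i, by linarith, by linarith, c, d⟩
  sw x y h1 h2 h3 h4 := by
    obtain ⟨i, a, b, c, d⟩ := τ.se (ℓ - x) y (by linarith) (by linarith) h3 h4
    exact ⟨i, by linarith, by linarith, c, d⟩
  disj i j h := by
    rcases τ.disj i j h with h | h | h | h
    · exact Or.inr (Or.inl (by linarith))
    · exact Or.inl (by linarith)
    · exact Or.inr (Or.inr (Or.inl h))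
    · exact Or.inr (Or.inr (Or.inr h))
  area i := by linear_combination τ.area i
  width_inj i j h := τ.width_inj i j (by linarith)
  proper u₀ u₁ v₀ v₁ hu hv h0 h1 h2 h3 H i j hij hi hj k := by
    obtain ⟨a, b, c, d⟩ := hi
    obtain ⟨a', b', c', d'⟩ := hj
    obtain ⟨p, q, r, s⟩ := τ.proper (ℓ - u₁) (ℓ - u₀) v₀ v₁ (by linarith) hv (by linarith)
      (by linarith) h2 h3 (fun i => by
        rcases H i with ⟨a, b, c, d⟩ | h | h | h | h
        · exact Or.inl ⟨by linarith, by linarith, c, d⟩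
        · exact Or.inr (Or.inr (Or.inl (by linarith)))
        · exact Or.inr (Or.inl (by linarith))
        · exact Or.inr (Or.inr (Or.inr (Or.inl h)))
        · exact Or.inr (Or.inr (Or.inr (Or.inr h)))) i j hij
      ⟨by linarith, by linarith, c, d⟩ ⟨by linarith, by linarith, c', d'⟩ k
    exact ⟨by linarith, by linarith, r, s⟩

/-- The mirror image under `(x, y) ↦ (y, x)`. -/
@[simps] def swap (τ : EquiTiling ι ℓ) : EquiTiling ι ℓ where
  x₀ := τ.y₀
  x₁ := τ.y₁
  y₀ := τ.x₀
  y₁ := τ.x₁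
  pos := τ.pos
  card := τ.card
  hx := τ.hy
  hy := τ.hx
  x₀_nonneg := τ.y₀_nonneg
  x₁_le := τ.y₁_le
  y₀_nonneg := τ.x₀_nonneg
  y₁_le := τ.x₁_le
  ne x y h1 h2 h3 h4 := by
    obtain ⟨i, a, b, c, d⟩ := τ.ne y x h3 h4 h1 h2
    exact ⟨i, c, d, a, b⟩
  nw x y h1 h2 h3 h4 := by
    obtain ⟨i, a, b, c, d⟩ := τ.se y x h3 h4 h1 h2
    exact ⟨i, c, d, a, b⟩
  se x y h1 h2 h3 h4 := by
    obtain ⟨i, a, b, c, d⟩ := τ.nw y x h3 h4 h1 h2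
    exact ⟨i, c, d, a, b⟩
  sw x y h1 h2 h3 h4 := by
    obtain ⟨i, a, b, c, d⟩ := τ.sw y x h3 h4 h1 h2
    exact ⟨i, c, d, a, b⟩
  disj i j h := by
    rcases τ.disj i j h with h | h | h | h <;> simp [h]
  area i := by linear_combination τ.area i
  width_inj i j h := by
    have hi := τ.area i
    have hj := τ.area j
    rw [h] at hi
    have h0 : τ.y₁ j - τ.y₀ j ≠ 0 := (sub_pos.2 (τ.hy j)).ne'
    exact τ.width_inj i j (mul_right_cancel₀ h0 (hi.trans hj.symm))
  proper u₀ u₁ v₀ v₁ hu hv h0 h1 h2 h3 H i j hij hi hj k := by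
    obtain ⟨a, b, c, d⟩ := hi
    obtain ⟨a', b', c', d'⟩ := hj
    obtain ⟨p, q, r, s⟩ := τ.proper v₀ v₁ u₀ u₁ hv hu h2 h3 h0 h1 (fun i => by
        rcases H i with ⟨a, b, c, d⟩ | h | h | h | h
        · exact Or.inl ⟨c, d, a, b⟩
        · simp [h]
        · simp [h]
        · simp [h]
        · simp [h]) i j hij ⟨c, d, a, b⟩ ⟨c', d', a', b'⟩ k
    exact ⟨r, s, p, q⟩

/-- The mirror image under `(x, y) ↦ (x, ℓ - y)`. -/
def flipY (τ : EquiTiling ι ℓ) : EquiTiling ι ℓ := τ.swap.flipX.swap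

@[simp] theorem flipY_x₀ (τ : EquiTiling ι ℓ) (i : ι) : τ.flipY.x₀ i = τ.x₀ i := rfl
@[simp] theorem flipY_x₁ (τ : EquiTiling ι ℓ) (i : ι) : τ.flipY.x₁ i = τ.x₁ i := rfl
@[simp] theorem flipY_y₀ (τ : EquiTiling ι ℓ) (i : ι) : τ.flipY.y₀ i = ℓ - τ.y₁ i := rfl
@[simp] theorem flipY_y₁ (τ : EquiTiling ι ℓ) (i : ι) : τ.flipY.y₁ i = ℓ - τ.y₀ i := rfl

/-- The image under the rotation `(x, y) ↦ (ℓ - y, x)`. -/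
def rot (τ : EquiTiling ι ℓ) : EquiTiling ι ℓ := τ.swap.flipX

@[simp] theorem rot_x₀ (τ : EquiTiling ι ℓ) (i : ι) : τ.rot.x₀ i = ℓ - τ.y₁ i := rfl
@[simp] theorem rot_x₁ (τ : EquiTiling ι ℓ) (i : ι) : τ.rot.x₁ i = ℓ - τ.y₀ i := rfl
@[simp] theorem rot_y₀ (τ : EquiTiling ι ℓ) (i : ι) : τ.rot.y₀ i = τ.x₀ i := rfl
@[simp] theorem rot_y₁ (τ : EquiTiling ι ℓ) (i : ι) : τ.rot.y₁ i = τ.x₁ i := rfl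

/-! ### Corners, full lines, and pairs of tiles that form a rectangle -/

variable (τ : EquiTiling ι ℓ)

/-- Most adjacencies below come from this: a tile in the wrong place would overlap another one and
so coincide with it. -/
theorem eq_of_overlap {i j : ι} (h1 : τ.x₀ i < τ.x₁ j) (h2 : τ.x₀ j < τ.x₁ i)
    (h3 : τ.y₀ i < τ.y₁ j) (h4 : τ.y₀ j < τ.y₁ i) : i = j := by
  by_contra h
  rcases τ.disj i j h with h | h | h | h <;> linarith

theorem finite_index (τ : EquiTiling ι ℓ) : Finite ι :=
  Nat.finite_of_card_ne_zero (by rw [τ.card]; norm_num)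

/-- Once seven different tiles are named, the tile at any germ can be found by elimination among
them. -/
theorem mem_of_nodup (τ : EquiTiling ι ℓ) (l : List ι) (hl : l.Nodup) (h7 : l.length = 7) (i : ι) : i ∈ l := by
  classical
  have := τ.finite_index
  have := Fintype.ofFinite ι
  have h : l.toFinset = Finset.univ := by
    apply Finset.eq_univ_of_card
    rw [List.toFinset_card_of_nodup hl, h7, ← Nat.card_eq_fintype_card, τ.card]
  have := Finset.mem_univ i
  rw [← h] at this
  simpa using this

theorem exists_ne_ne (τ : EquiTiling ι ℓ) (i j : ι) : ∃ k, k ≠ i ∧ k ≠ j := by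
  classical
  have := τ.finite_index
  have := Fintype.ofFinite ι
  by_contra! h
  have h1 : (Finset.univ : Finset ι) ⊆ {i, j} := fun k _ => by
    by_cases hk : k = i
    · simp [hk]
    · simp [h k hk]
  have h2 := (Finset.card_le_card h1).trans Finset.card_le_two
  rw [Finset.card_univ, ← Nat.card_eq_fintype_card, τ.card] at h2
  omega

theorem exists_topLeft : ∃ i, τ.x₀ i = 0 ∧ τ.y₁ i = ℓ := by
  obtain ⟨i, h1, -, -, h4⟩ := τ.se 0 ℓ le_rfl τ.pos τ.pos le_rfl
  exact ⟨i, le_antisymm h1 (τ.x₀_nonneg i), le_antisymm (τ.y₁_le i) h4⟩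

theorem exists_bottomLeft : ∃ i, τ.x₀ i = 0 ∧ τ.y₀ i = 0 := by
  obtain ⟨i, h1, -, h3, -⟩ := τ.ne 0 0 le_rfl τ.pos le_rfl τ.pos
  exact ⟨i, le_antisymm h1 (τ.x₀_nonneg i), le_antisymm h3 (τ.y₀_nonneg i)⟩

theorem exists_topRight : ∃ i, τ.x₁ i = ℓ ∧ τ.y₁ i = ℓ := by
  obtain ⟨i, -, h2, -, h4⟩ := τ.sw ℓ ℓ τ.pos le_rfl τ.pos le_rfl
  exact ⟨i, le_antisymm (τ.x₁_le i) h2, le_antisymm (τ.y₁_le i) h4⟩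

theorem exists_bottomRight : ∃ i, τ.x₁ i = ℓ ∧ τ.y₀ i = 0 := by
  obtain ⟨i, -, h2, h3, -⟩ := τ.nw ℓ 0 τ.pos le_rfl le_rfl τ.pos
  exact ⟨i, le_antisymm (τ.x₁_le i) h2, le_antisymm h3 (τ.y₀_nonneg i)⟩

theorem eq_topLeft {i j : ι} (h1 : τ.x₀ i = 0) (h2 : τ.y₁ i = ℓ) (h3 : τ.x₀ j = 0)
    (h4 : τ.y₁ j = ℓ) : i = j := by
  have := τ.hx i; have := τ.hx j; have := τ.hy i; have := τ.hy j
  apply τ.eq_of_overlap <;> linarith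

theorem eq_bottomLeft {i j : ι} (h1 : τ.x₀ i = 0) (h2 : τ.y₀ i = 0) (h3 : τ.x₀ j = 0)
    (h4 : τ.y₀ j = 0) : i = j := by
  have := τ.hx i; have := τ.hx j; have := τ.hy i; have := τ.hy j
  apply τ.eq_of_overlap <;> linarith

theorem eq_bottomRight {i j : ι} (h1 : τ.x₁ i = ℓ) (h2 : τ.y₀ i = 0) (h3 : τ.x₁ j = ℓ)
    (h4 : τ.y₀ j = 0) : i = j := by
  have := τ.hx i; have := τ.hx j; have := τ.hy i; have := τ.hy j
  apply τ.eq_of_overlap <;> linarith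

/-- Every horizontal line through the interior of the square crosses the interior of a tile. -/
theorem exists_cross_y {t : ℝ} (h0 : 0 < t) (h1 : t < ℓ) : ∃ i, τ.y₀ i < t ∧ t < τ.y₁ i := by
  by_contra! H
  obtain ⟨A, -, hA⟩ := τ.exists_topLeft
  obtain ⟨D, -, hD⟩ := τ.exists_bottomLeft
  have hA' : t ≤ τ.y₀ A := by
    by_contra! h
    linarith [H A h]
  have hD' : τ.y₁ D ≤ t := H D (by linarith)
  obtain ⟨K, hKA, hKD⟩ := τ.exists_ne_ne A D
  have fA := τ.hy A
  have fD := τ.hy D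
  by_cases hK : τ.y₀ K < t
  -- An uncrossed line cuts the square into two rectangles, with `A` above and `D` below. The half
  -- that contains the third tile `K` contains two tiles but not all.
  · have := τ.proper 0 ℓ 0 t τ.pos h0 le_rfl le_rfl le_rfl h1.le (fun i => by
      by_cases h : τ.y₀ i < t
      · exact Or.inl ⟨τ.x₀_nonneg i, τ.x₁_le i, τ.y₀_nonneg i, H i h⟩
      · simp [not_lt.1 h]) K D hKD ⟨τ.x₀_nonneg _, τ.x₁_le _, τ.y₀_nonneg _, H _ hK⟩
      ⟨τ.x₀_nonneg _, τ.x₁_le _, τ.y₀_nonneg _, hD'⟩ A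
    linarith [this.2.2.2]
  · have := τ.proper 0 ℓ t ℓ τ.pos h1 le_rfl le_rfl h0.le le_rfl (fun i => by
      by_cases h : τ.y₀ i < t
      · simp [H i h]
      · exact Or.inl ⟨τ.x₀_nonneg i, τ.x₁_le i, not_lt.1 h, τ.y₁_le i⟩) K A hKA
      ⟨τ.x₀_nonneg _, τ.x₁_le _, not_lt.1 hK, τ.y₁_le _⟩
      ⟨τ.x₀_nonneg _, τ.x₁_le _, hA', τ.y₁_le _⟩ D
    linarith [this.2.2.1]

theorem exists_cross_x {t : ℝ} (h0 : 0 < t) (h1 : t < ℓ) : ∃ i, τ.x₀ i < t ∧ t < τ.x₁ i :=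
  τ.swap.exists_cross_y h0 h1

/-- A horizontal side of a tile of full width, unless on the boundary of the square, would be a line
that no tile crosses. If both sides are on the boundary, the tile is the whole square and its area
is wrong. -/
theorem not_span_x {i : ι} (h0 : τ.x₀ i = 0) (h1 : τ.x₁ i = ℓ) : False := by
  have key : ∀ t, 0 < t → t < ℓ → (t = τ.y₀ i ∨ t = τ.y₁ i) → False := by
    intro t ht0 ht1 ht
    obtain ⟨j, hj0, hj1⟩ := τ.exists_cross_y ht0 ht1
    have := τ.hx j
    have := τ.hy i
    have := τ.x₀_nonneg j
    have := τ.x₁_le j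
    have hij : j = i := by
      apply τ.eq_of_overlap <;> first | linarith | (rcases ht with rfl | rfl <;> linarith)
    subst hij
    rcases ht with rfl | rfl <;> linarith
  have a := τ.y₀_nonneg i
  have b := τ.y₁_le i
  have c := τ.hy i
  rcases a.eq_or_lt with a | a
  · rcases b.eq_or_lt with b | b
    · have := τ.area i
      rw [h0, h1, ← a, b] at this
      nlinarith [τ.pos]
    · exact key _ (by linarith) b (Or.inr rfl)
  · exact key _ a (by linarith) (Or.inl rfl)

theorem not_span_y {i : ι} (h0 : τ.y₀ i = 0) (h1 : τ.y₁ i = ℓ) : False :=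
  τ.swap.not_span_x h0 h1

/-- Two tiles never form a rectangle, one on top of the other. -/
theorem not_stacked {i j : ι} (h0 : τ.x₀ i = τ.x₀ j) (h1 : τ.x₁ i = τ.x₁ j)
    (h : τ.y₁ j = τ.y₀ i) : False := by
  have fi := τ.hy i
  have fj := τ.hy j
  have hij : i ≠ j := by rintro rfl; linarith
  obtain ⟨k, hki, hkj⟩ := τ.exists_ne_ne i j
  have := τ.proper (τ.x₀ i) (τ.x₁ i) (τ.y₀ j) (τ.y₁ i) (τ.hx i) (by linarith) (τ.x₀_nonneg i)
    (τ.x₁_le i) (τ.y₀_nonneg j) (τ.y₁_le i) (fun m => by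
      by_cases hmi : m = i
      · subst hmi
        exact Or.inl ⟨le_rfl, le_rfl, by linarith, le_rfl⟩
      by_cases hmj : m = j
      · subst hmj
        exact Or.inl ⟨by linarith, by linarith, le_rfl, by linarith⟩
      have fm := τ.hy m
      rcases τ.disj m i hmi with a | a | a | a
      · simp [a]
      · simp [a]
      · rcases τ.disj m j hmj with b | b | b | b
        · simp [h0, b]
        · simp [h1, b]
        · simp [b]
        · linarith
      · simp [a]) i j hij ⟨le_rfl, le_rfl, by linarith, le_rfl⟩
      ⟨by linarith, by linarith, le_rfl, by linarith⟩ k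
  -- The third tile `k` now lies in the union of `i` and `j`, so it overlaps one of them.
  obtain ⟨a, b, c, d⟩ := this
  have fk := τ.hy k
  have gk := τ.hx k
  rcases τ.disj k i hki with e | e | e | e <;> rcases τ.disj k j hkj with f | f | f | f <;> linarith

theorem not_side_by_side {i j : ι} (h0 : τ.y₀ i = τ.y₀ j) (h1 : τ.y₁ i = τ.y₁ j)
    (h : τ.x₁ j = τ.x₀ i) : False :=
  τ.swap.not_stacked h0 h1 h

/-! ### Valleys next to extreme boundary tiles -/

/-- Below a tile whose two neighbours reach further down there are at least two tiles, which
fill the valley between these neighbours. -/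
theorem valley_of_blocked {T : ι} (hT : 0 < τ.y₀ T)
    (hl : τ.x₀ T = 0 ∨ ∃ L, τ.x₁ L = τ.x₀ T ∧ τ.y₀ L < τ.y₀ T ∧ τ.y₀ T ≤ τ.y₁ L)
    (hr : τ.x₁ T = ℓ ∨ ∃ R, τ.x₀ R = τ.x₁ T ∧ τ.y₀ R < τ.y₀ T ∧ τ.y₀ T ≤ τ.y₁ R) :
    ∃ U V, τ.x₀ U = τ.x₀ T ∧ τ.x₁ V = τ.x₁ T ∧ τ.y₁ U = τ.y₀ T ∧ τ.y₁ V = τ.y₀ T ∧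
      τ.x₁ U ≤ τ.x₀ V := by
  have ty := τ.hy T
  have tx := τ.hx T
  have a0 := τ.x₀_nonneg T
  have a1 := τ.x₁_le T
  have a2 := τ.y₁_le T
  obtain ⟨U, u1, u2, u3, u4⟩ := τ.se (τ.x₀ T) (τ.y₀ T) a0 (by linarith) hT (by linarith)
  obtain ⟨V, v1, v2, v3, v4⟩ := τ.sw (τ.x₁ T) (τ.y₀ T) (by linarith) a1 hT (by linarith)
  have uy : τ.y₁ U = τ.y₀ T := by
    by_contra h
    have h := lt_of_le_of_ne u4 (Ne.symm h)
    have : U = T := by apply τ.eq_of_overlap <;> linarith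
    subst this
    linarith
  have vy : τ.y₁ V = τ.y₀ T := by
    by_contra h
    have h := lt_of_le_of_ne v4 (Ne.symm h)
    have : V = T := by apply τ.eq_of_overlap <;> linarith
    subst this
    linarith
  have ux : τ.x₀ U = τ.x₀ T := by
    rcases hl with h | ⟨L, l1, l2, l3⟩
    · linarith [τ.x₀_nonneg U]
    · by_contra h
      have h := lt_of_le_of_ne u1 h
      have := τ.hx L
      have : U = L := by apply τ.eq_of_overlap <;> linarith
      subst this
      linarith
  have vx : τ.x₁ V = τ.x₁ T := by
    rcases hr with h | ⟨R, l1, l2, l3⟩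
    · linarith [τ.x₁_le V]
    · by_contra h
      have h := lt_of_le_of_ne v2 (Ne.symm h)
      have := τ.hx R
      have : V = R := by apply τ.eq_of_overlap <;> linarith
      subst this
      linarith
  refine ⟨U, V, ux, vx, uy, vy, ?_⟩
  -- If `U` and `V` overlapped, they would be one tile of the same width as `T`, stacked with it.
  by_contra! h
  have := τ.hy U
  have := τ.hy V
  have : U = V := by apply τ.eq_of_overlap <;> linarith
  subst this
  exact τ.not_stacked ux.symm vx.symm uy

/-- A neighbour of `T` on the top side is at least as deep as `T`, and not equally deep, since the
two would form a rectangle. So `T` is blocked on both sides. -/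
theorem valley_top {T : ι} (hT : τ.y₁ T = ℓ) (hmin : ∀ j, τ.y₁ j = ℓ → τ.y₀ j ≤ τ.y₀ T) :
    ∃ U V, τ.x₀ U = τ.x₀ T ∧ τ.x₁ V = τ.x₁ T ∧ τ.y₁ U = τ.y₀ T ∧ τ.y₁ V = τ.y₀ T ∧
      τ.x₁ U ≤ τ.x₀ V := by
  have h0 : 0 < τ.y₀ T := lt_of_le_of_ne (τ.y₀_nonneg T) fun h => τ.not_span_y h.symm hT
  have ty := τ.hy T
  have tx := τ.hx T
  have t0 := τ.x₀_nonneg T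
  have t1 := τ.x₁_le T
  apply τ.valley_of_blocked h0
  · rcases t0.eq_or_lt with h | h
    · exact Or.inl h.symm
    · obtain ⟨L, l1, l2, l3, l4⟩ := τ.sw (τ.x₀ T) ℓ h (by linarith) τ.pos le_rfl
      have ly : τ.y₁ L = ℓ := le_antisymm (τ.y₁_le L) l4
      have lx : τ.x₁ L = τ.x₀ T := by
        by_contra h
        have h := lt_of_le_of_ne l2 (Ne.symm h)
        have : L = T := by apply τ.eq_of_overlap <;> linarith
        subst this
        linarith
      refine Or.inr ⟨L, lx, lt_of_le_of_ne (hmin L ly) fun h => ?_, by linarith⟩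
      exact τ.not_side_by_side h.symm (hT.trans ly.symm) lx
  · rcases t1.eq_or_lt with h | h
    · exact Or.inl h
    · obtain ⟨L, l1, l2, l3, l4⟩ := τ.se (τ.x₁ T) ℓ (by linarith) h τ.pos le_rfl
      have ly : τ.y₁ L = ℓ := le_antisymm (τ.y₁_le L) l4
      have lx : τ.x₀ L = τ.x₁ T := by
        by_contra h
        have h := lt_of_le_of_ne l1 h
        have : L = T := by apply τ.eq_of_overlap <;> linarith
        subst this
        linarith
      refine Or.inr ⟨L, lx, lt_of_le_of_ne (hmin L ly) fun h => ?_, by linarith⟩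
      exact τ.not_side_by_side h (ly.trans hT.symm) lx.symm

theorem valley_left {T : ι} (hT : τ.x₀ T = 0) (hmin : ∀ j, τ.x₀ j = 0 → τ.x₁ T ≤ τ.x₁ j) :
    ∃ U V, τ.y₁ U = τ.y₁ T ∧ τ.y₀ V = τ.y₀ T ∧ τ.x₀ U = τ.x₁ T ∧ τ.x₀ V = τ.x₁ T ∧
      τ.y₁ V ≤ τ.y₀ U := by
  obtain ⟨V, U, h1, h2, h3, h4, h5⟩ := τ.flipX.swap.valley_top (T := T) (by simp [hT])
    (fun j hj => by simp at hj ⊢; linarith [hmin j hj])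
  simp at h1 h2 h3 h4 h5
  exact ⟨U, V, h2, h1, h4, h3, h5⟩

theorem valley_bottom {T : ι} (hT : τ.y₀ T = 0) (hmin : ∀ j, τ.y₀ j = 0 → τ.y₁ T ≤ τ.y₁ j) :
    ∃ U V, τ.x₀ U = τ.x₀ T ∧ τ.x₁ V = τ.x₁ T ∧ τ.y₀ U = τ.y₁ T ∧ τ.y₀ V = τ.y₁ T ∧
      τ.x₁ U ≤ τ.x₀ V := by
  obtain ⟨U, V, h1, h2, h3, h4, h5⟩ := τ.flipY.valley_top (T := T) (by simp [hT])
    (fun j hj => by simp at hj ⊢; linarith [hmin j hj])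
  simp at h1 h2 h3 h4 h5
  exact ⟨U, V, h1, h2, h3, h4, h5⟩

theorem exists_shallowest_top : ∃ T, τ.y₁ T = ℓ ∧ ∀ j, τ.y₁ j = ℓ → τ.y₀ j ≤ τ.y₀ T := by
  have := τ.finite_index
  obtain ⟨A, -, hA⟩ := τ.exists_topLeft
  exact Set.exists_max_image {j | τ.y₁ j = ℓ} τ.y₀ (Set.toFinite _) ⟨A, hA⟩

theorem exists_narrowest_left : ∃ T, τ.x₀ T = 0 ∧ ∀ j, τ.x₀ j = 0 → τ.x₁ T ≤ τ.x₁ j := by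
  have := τ.finite_index
  obtain ⟨A, hA, -⟩ := τ.exists_topLeft
  exact Set.exists_min_image {j | τ.x₀ j = 0} τ.x₁ (Set.toFinite _) ⟨A, hA⟩

theorem exists_narrowest_right : ∃ T, τ.x₁ T = ℓ ∧ ∀ j, τ.x₁ j = ℓ → τ.x₀ j ≤ τ.x₀ T := by
  have := τ.finite_index
  obtain ⟨A, hA, -⟩ := τ.exists_topRight
  exact Set.exists_max_image {j | τ.x₁ j = ℓ} τ.x₀ (Set.toFinite _) ⟨A, hA⟩

theorem exists_shallowest_bottom : ∃ T, τ.y₀ T = 0 ∧ ∀ j, τ.y₀ j = 0 → τ.y₁ T ≤ τ.y₁ j := by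
  have := τ.finite_index
  obtain ⟨A, -, hA⟩ := τ.exists_bottomLeft
  exact Set.exists_min_image {j | τ.y₀ j = 0} τ.y₁ (Set.toFinite _) ⟨A, hA⟩

end EquiTiling

/-- Among tiles of equal area the narrower one is taller. This is the only use of the areas in
`narrowest_left_in_corner` and in `SpiralCoords.not_x₁_lt`. -/
theorem snd_lt_of_mul_eq {p q p' q' : ℝ} (h : p * q = p' * q') (hp : p < p') (h0 : 0 < p)
    (hq : 0 < q') : q' < q := by
  by_contra! hle
  have h1 := mul_le_mul_of_nonneg_left hle h0.le
  have h2 := mul_lt_mul_of_pos_right hp hq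
  linarith

/-! ### Extreme boundary tiles lie in corners -/

namespace EquiTiling

variable {ι : Type} {ℓ : ℝ} (τ : EquiTiling ι ℓ)

set_option maxHeartbeats 2000000 in
/-- The narrowest tile on the left side of the square lies in a corner. -/
theorem narrowest_left_in_corner {E : ι} (hE : τ.x₀ E = 0)
    (hmin : ∀ j, τ.x₀ j = 0 → τ.x₁ E ≤ τ.x₁ j) (h0 : 0 < τ.y₀ E) (h1 : τ.y₁ E < ℓ) : False := by
  obtain ⟨A, ax, ay⟩ := τ.exists_topLeft
  obtain ⟨B, bx, by'⟩ := τ.exists_topRight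
  obtain ⟨C, cx, cy⟩ := τ.exists_bottomRight
  obtain ⟨D, dx, dy⟩ := τ.exists_bottomLeft
  obtain ⟨F, G, fy, gy, fx, gx, gf⟩ := τ.valley_left hE hmin
  have hx := τ.hx
  have hy := τ.hy
  have Ax : τ.x₁ A < ℓ := lt_of_le_of_ne (τ.x₁_le A) fun h => τ.not_span_x ax h
  have Dx : τ.x₁ D < ℓ := lt_of_le_of_ne (τ.x₁_le D) fun h => τ.not_span_x dx h
  have Ex : τ.x₁ E < ℓ := lt_of_le_of_ne (τ.x₁_le E) fun h => τ.not_span_x hE h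
  have Bx : 0 < τ.x₀ B := lt_of_le_of_ne (τ.x₀_nonneg B) fun h => τ.not_span_x h.symm bx
  have Cx : 0 < τ.x₀ C := lt_of_le_of_ne (τ.x₀_nonneg C) fun h => τ.not_span_x h.symm cx
  have Ay : 0 < τ.y₀ A := lt_of_le_of_ne (τ.y₀_nonneg A) fun h => τ.not_span_y h.symm ay
  have By : 0 < τ.y₀ B := lt_of_le_of_ne (τ.y₀_nonneg B) fun h => τ.not_span_y h.symm by'
  have Cy : τ.y₁ C < ℓ := lt_of_le_of_ne (τ.y₁_le C) fun h => τ.not_span_y cy h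
  have Dy : τ.y₁ D < ℓ := lt_of_le_of_ne (τ.y₁_le D) fun h => τ.not_span_y dy h
  have hxA := hx A; have hxB := hx B; have hxC := hx C; have hxD := hx D
  have hxE := hx E; have hxF := hx F; have hxG := hx G
  have hyA := hy A; have hyB := hy B; have hyC := hy C; have hyD := hy D
  have hyE := hy E; have hyF := hy F; have hyG := hy G
  have nAB : A ≠ B := by rintro rfl; linarith
  have nAC : A ≠ C := by rintro rfl; linarith
  have nAD : A ≠ D := by rintro rfl; linarith
  have nAE : A ≠ E := by rintro rfl; linarith
  have nAF : A ≠ F := by rintro rfl; linarith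
  have nAG : A ≠ G := by rintro rfl; linarith
  have nBC : B ≠ C := by rintro rfl; linarith
  have nBD : B ≠ D := by rintro rfl; linarith
  have nBE : B ≠ E := by rintro rfl; linarith
  have nBF : B ≠ F := by rintro rfl; linarith
  have nBG : B ≠ G := by rintro rfl; linarith
  have nCD : C ≠ D := by rintro rfl; linarith
  have nCE : C ≠ E := by rintro rfl; linarith
  have nCF : C ≠ F := by rintro rfl; linarith
  have nCG : C ≠ G := by rintro rfl; linarith
  have nDE : D ≠ E := by rintro rfl; linarith
  have nDF : D ≠ F := by rintro rfl; linarith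
  have nDG : D ≠ G := by rintro rfl; linarith
  have nEF : E ≠ F := by rintro rfl; linarith
  have nEG : E ≠ G := by rintro rfl; linarith
  have nFG : F ≠ G := by rintro rfl; linarith
  -- The corner tiles, `E` and the valley tiles `F`, `G` are all the tiles.
  have all : ∀ i, i = A ∨ i = B ∨ i = C ∨ i = D ∨ i = E ∨ i = F ∨ i = G := fun i => by
    simpa using τ.mem_of_nodup [A, B, C, D, E, F, G] (by simp [*]) rfl i
  -- If `F` reached the right side, the upper sides of `E` and `F` would form a full line; likewise
  -- the lower sides of `E` and `G`.
  have Fx : τ.x₁ F < ℓ := by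
    refine lt_of_le_of_ne (τ.x₁_le F) fun h => ?_
    obtain ⟨j, j0, j1⟩ := τ.exists_cross_y (t := τ.y₁ E) (by linarith) h1
    have := hx j; have := τ.x₁_le j; have := τ.x₀_nonneg j
    by_cases hj : τ.x₀ j < τ.x₁ E
    · have : j = E := by apply τ.eq_of_overlap <;> linarith
      subst this; linarith
    · have : j = F := by apply τ.eq_of_overlap <;> linarith
      subst this; linarith
  have Gx : τ.x₁ G < ℓ := by
    refine lt_of_le_of_ne (τ.x₁_le G) fun h => ?_
    obtain ⟨j, j0, j1⟩ := τ.exists_cross_y (t := τ.y₀ E) (by linarith) (by linarith)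
    have := hx j; have := τ.x₁_le j; have := τ.x₀_nonneg j
    by_cases hj : τ.x₀ j < τ.x₁ E
    · have : j = E := by apply τ.eq_of_overlap <;> linarith
      subst this; linarith
    · have : j = G := by apply τ.eq_of_overlap <;> linarith
      subst this; linarith
  have eBC : τ.y₁ C = τ.y₀ B := by
    have h : τ.y₁ C ≤ τ.y₀ B := by
      by_contra! h
      exact nBC (by apply τ.eq_of_overlap <;> linarith)
    obtain ⟨K, k1, k2, k3, k4⟩ := τ.sw ℓ (τ.y₀ B) τ.pos le_rfl By (by linarith)
    rcases all K with rfl | rfl | rfl | rfl | rfl | rfl | rfl <;> linarith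
  have eAB : τ.x₁ A = τ.x₀ B := by
    have h : τ.x₁ A ≤ τ.x₀ B := by
      by_contra! h
      exact nAB (by apply τ.eq_of_overlap <;> linarith)
    obtain ⟨K, k1, k2, k3, k4⟩ := τ.se (τ.x₁ A) ℓ (by linarith) (by linarith) τ.pos le_rfl
    rcases all K with rfl | rfl | rfl | rfl | rfl | rfl | rfl <;> linarith
  have eCD : τ.x₁ D = τ.x₀ C := by
    have h : τ.x₁ D ≤ τ.x₀ C := by
      by_contra! h
      exact nCD (by apply τ.eq_of_overlap <;> linarith)
    obtain ⟨K, k1, k2, k3, k4⟩ := τ.ne (τ.x₁ D) 0 (by linarith) (by linarith) le_rfl τ.pos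
    rcases all K with rfl | rfl | rfl | rfl | rfl | rfl | rfl <;> linarith
  have lAE : τ.y₁ E ≤ τ.y₀ A := by
    by_contra! h
    exact nAE (by apply τ.eq_of_overlap <;> linarith)
  have lDE : τ.y₁ D ≤ τ.y₀ E := by
    by_contra! h
    exact nDE (by apply τ.eq_of_overlap <;> linarith)
  have eAE : τ.y₁ E = τ.y₀ A := by
    obtain ⟨K, k1, k2, k3, k4⟩ := τ.ne 0 (τ.y₁ E) le_rfl τ.pos (by linarith) h1
    rcases all K with rfl | rfl | rfl | rfl | rfl | rfl | rfl <;> linarith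
  have eDE : τ.y₁ D = τ.y₀ E := by
    obtain ⟨K, k1, k2, k3, k4⟩ := τ.se 0 (τ.y₀ E) le_rfl τ.pos h0 (by linarith)
    rcases all K with rfl | rfl | rfl | rfl | rfl | rfl | rfl <;> linarith
  have eA : τ.x₁ E < τ.x₁ A :=
    lt_of_le_of_ne (hmin A ax) fun h => nAE (τ.width_inj _ _ (by linarith))
  have eD : τ.x₁ E < τ.x₁ D :=
    lt_of_le_of_ne (hmin D dx) fun h => nDE (τ.width_inj _ _ (by linarith))
  -- If `A` were deeper than `B`, it would end beside `C`, which forces `D` to be as wide as `A`.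
  -- Then the vertical line through the right side of `A` would cross no tile. The same argument
  -- upside down gives `hD`.
  have hA : τ.y₀ B < τ.y₀ A := by
    by_contra! h
    rcases h.eq_or_lt with h | h
    · exact τ.not_side_by_side h.symm (by linarith) eAB
    have l : τ.x₁ A ≤ τ.x₁ D := by
      by_contra! h
      exact nAC (by apply τ.eq_of_overlap <;> linarith)
    have e : τ.x₁ D = τ.x₁ A := by
      obtain ⟨K, k1, k2, k3, k4⟩ := τ.ne (τ.x₁ A) (τ.y₀ A) (by linarith) (by linarith)
        (by linarith) (by linarith)
      rcases all K with rfl | rfl | rfl | rfl | rfl | rfl | rfl <;> linarith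
    have lF : τ.x₁ F ≤ τ.x₀ C := by
      by_contra! h
      exact nCF (by apply τ.eq_of_overlap <;> linarith)
    have lG : τ.x₁ G ≤ τ.x₀ C := by
      by_contra! h
      exact nCG (by apply τ.eq_of_overlap <;> linarith)
    obtain ⟨K, k1, k2⟩ := τ.exists_cross_x (t := τ.x₁ A) (by linarith) (by linarith)
    rcases all K with rfl | rfl | rfl | rfl | rfl | rfl | rfl <;> linarith
  have hD : τ.y₁ D < τ.y₀ B := by
    by_contra! h
    rcases h.eq_or_lt with h | h
    · exact τ.not_side_by_side (i := C) (j := D) (by linarith) (by linarith) eCD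
    have l : τ.x₁ D ≤ τ.x₁ A := by
      by_contra! h
      exact nBD (by apply τ.eq_of_overlap <;> linarith)
    have e : τ.x₁ D = τ.x₁ A := by
      obtain ⟨K, k1, k2, k3, k4⟩ := τ.se (τ.x₁ D) (τ.y₁ D) (by linarith) (by linarith)
        (by linarith) (by linarith)
      rcases all K with rfl | rfl | rfl | rfl | rfl | rfl | rfl <;> linarith
    have lF : τ.x₁ F ≤ τ.x₀ B := by
      by_contra! h
      exact nBF (by apply τ.eq_of_overlap <;> linarith)
    have lG : τ.x₁ G ≤ τ.x₀ B := by
      by_contra! h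
      exact nBG (by apply τ.eq_of_overlap <;> linarith)
    obtain ⟨K, k1, k2⟩ := τ.exists_cross_x (t := τ.x₁ A) (by linarith) (by linarith)
    rcases all K with rfl | rfl | rfl | rfl | rfl | rfl | rfl <;> linarith
  have eF : τ.x₁ F = τ.x₁ A := by
    have l : τ.x₁ F ≤ τ.x₀ B := by
      by_contra! h
      exact nBF (by apply τ.eq_of_overlap <;> linarith)
    obtain ⟨K, k1, k2, k3, k4⟩ := τ.sw (τ.x₁ A) (τ.y₀ A) (by linarith) (by linarith)
        (by linarith) (by linarith)
    rcases all K with rfl | rfl | rfl | rfl | rfl | rfl | rfl <;> linarith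
  have eG : τ.x₁ G = τ.x₁ D := by
    have l : τ.x₁ G ≤ τ.x₀ C := by
      by_contra! h
      exact nCG (by apply τ.eq_of_overlap <;> linarith)
    obtain ⟨K, k1, k2, k3, k4⟩ := τ.nw (τ.x₁ D) (τ.y₁ D) (by linarith) (by linarith)
        (by linarith) (by linarith)
    rcases all K with rfl | rfl | rfl | rfl | rfl | rfl | rfl <;> linarith
  have aAD := (τ.area A).trans (τ.area D).symm
  have aBC := (τ.area B).trans (τ.area C).symm
  have aFG := (τ.area F).trans (τ.area G).symm
  -- The line between `B` and `C` is level with the top of `G` in the first case and with the bottom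
  -- of `F` in the last. Say `A` is narrower than `D`. Then `F` is narrower than `G`, so `A` and `F`
  -- together are taller than `D` and `G` together, and the part of the square above the line is the
  -- taller one. But `C` is narrower than `B`, hence taller, and the part below is the taller one.
  rcases lt_trichotomy (τ.x₁ A) (τ.x₁ D) with h | h | h
  · have lG : τ.y₁ G ≤ τ.y₀ B := by
      by_contra! h
      exact nBG (by apply τ.eq_of_overlap <;> linarith)
    have l : τ.y₀ B ≤ τ.y₁ G := by
      obtain ⟨K, k1, k2, k3, k4⟩ := τ.sw (τ.x₁ D) (τ.y₀ B) (by linarith) (by linarith)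
        (by linarith) (by linarith)
      rcases all K with rfl | rfl | rfl | rfl | rfl | rfl | rfl <;> linarith
    have r1 := snd_lt_of_mul_eq aAD (by linarith) (by linarith) (by linarith)
    have r2 := snd_lt_of_mul_eq aBC.symm (by linarith) (by linarith) (by linarith)
    have r3 := snd_lt_of_mul_eq aFG (by linarith) (by linarith) (by linarith)
    linarith
  · exact nAD (τ.width_inj _ _ (by linarith))
  · have lF : τ.y₀ B ≤ τ.y₀ F := by
      by_contra! h
      exact nCF (by apply τ.eq_of_overlap <;> linarith)
    have l : τ.y₀ F ≤ τ.y₀ B := by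
      obtain ⟨K, k1, k2, k3, k4⟩ := τ.nw (τ.x₁ A) (τ.y₀ B) (by linarith) (by linarith)
        (by linarith) (by linarith)
      rcases all K with rfl | rfl | rfl | rfl | rfl | rfl | rfl <;> linarith
    have r1 := snd_lt_of_mul_eq aAD.symm (by linarith) (by linarith) (by linarith)
    have r2 := snd_lt_of_mul_eq aBC (by linarith) (by linarith) (by linarith)
    have r3 := snd_lt_of_mul_eq aFG.symm (by linarith) (by linarith) (by linarith)
    linarith

/-! ### Pinwheels and the spiral pattern -/

/-- The tiles `A`, `B`, `C`, `D` in the corners (top left, top right, bottom right, bottom left)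
are the shallowest ones on the top, right, bottom and left side, respectively. -/
structure IsPinwheel (A B C D : ι) : Prop where
  ax : τ.x₀ A = 0
  ay : τ.y₁ A = ℓ
  bx : τ.x₁ B = ℓ
  by' : τ.y₁ B = ℓ
  cx : τ.x₁ C = ℓ
  cy : τ.y₀ C = 0
  dx : τ.x₀ D = 0
  dy : τ.y₀ D = 0
  amin : ∀ j, τ.y₁ j = ℓ → τ.y₀ j ≤ τ.y₀ A
  bmin : ∀ j, τ.x₁ j = ℓ → τ.x₀ j ≤ τ.x₀ B
  cmin : ∀ j, τ.y₀ j = 0 → τ.y₁ C ≤ τ.y₁ j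
  dmin : ∀ j, τ.x₀ j = 0 → τ.x₁ D ≤ τ.x₁ j

variable {τ} {A B C D : ι}

/-- A quarter turn permutes the corners cyclically, so each fact about one side of a pinwheel yields
the facts about the other three. -/
theorem IsPinwheel.rot (h : τ.IsPinwheel A B C D) : τ.rot.IsPinwheel B C D A where
  ax := by simp [h.by']
  ay := h.bx
  bx := by simp [h.cy]
  by' := h.cx
  cx := by simp [h.dy]
  cy := h.dx
  dx := by simp [h.ay]
  dy := h.ax
  amin := h.bmin
  bmin j hj := by simp at hj; simp; linarith [h.cmin j hj]
  cmin := h.dmin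
  dmin j hj := by simp at hj; simp; linarith [h.amin j (by linarith)]

/-- The tiles below the top left tile of a pinwheel. -/
theorem IsPinwheel.valley (h : τ.IsPinwheel A B C D) :
    ∃ U P, τ.x₀ U = 0 ∧ τ.y₁ U = τ.y₀ A ∧ τ.x₁ U ≤ τ.x₀ P ∧ τ.x₁ P = τ.x₁ A ∧
      τ.y₁ P = τ.y₀ A ∧ 0 < τ.x₀ P ∧ τ.x₁ P < ℓ ∧ 0 < τ.y₀ P ∧ τ.y₁ P < ℓ := by
  obtain ⟨U, P, h1, h2, h3, h4, h5⟩ := τ.valley_top h.ay h.amin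
  have hU := τ.hx U
  have hA := τ.hy A
  have ha := τ.hx A
  have hP := τ.hy P
  have h0 := h.ax
  have hl := h.ay
  have a1 : τ.x₁ A < ℓ := lt_of_le_of_ne (τ.x₁_le A) fun h' => τ.not_span_x h.ax h'
  refine ⟨U, P, by linarith, h3, h5, h2, h4, by linarith, by linarith, ?_, by linarith⟩
  -- If `P` stood on the bottom side, the right sides of `A` and `P` would form a full vertical
  -- line. So `P` touches no side of the square.
  refine lt_of_le_of_ne (τ.y₀_nonneg P) fun hb => ?_
  obtain ⟨j, j0, j1⟩ := τ.exists_cross_x (t := τ.x₁ A) (by linarith) (by linarith)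
  have := τ.hy j; have := τ.y₁_le j; have := τ.y₀_nonneg j
  have := τ.hx P
  by_cases hj : τ.y₀ A < τ.y₁ j
  · have : j = A := by apply τ.eq_of_overlap <;> linarith
    subst this; linarith
  · have : j = P := by apply τ.eq_of_overlap <;> linarith
    subst this; linarith

theorem exists_not_mem (τ : EquiTiling ι ℓ) (l : List ι) (hl : l.length < 7) : ∃ i, i ∉ l := by
  classical
  have := τ.finite_index
  have := Fintype.ofFinite ι
  by_contra! h
  have h1 : l.toFinset = Finset.univ := by ext i; simp [h i]
  have h2 := l.toFinset_card_le
  rw [h1, Finset.card_univ, ← Nat.card_eq_fintype_card, τ.card] at h2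
  omega

/-- A pinwheel has a further tile on the boundary of the square. -/
theorem IsPinwheel.exists_middle (h : τ.IsPinwheel A B C D) :
    ∃ E, E ≠ A ∧ E ≠ B ∧ E ≠ C ∧ E ≠ D ∧
      (τ.x₀ E = 0 ∨ τ.x₁ E = ℓ ∨ τ.y₀ E = 0 ∨ τ.y₁ E = ℓ) := by
  by_contra! H
  have ⟨ax, ay, bx, by', cx, cy, dx, dy, amin, bmin, cmin, dmin⟩ := h
  obtain ⟨UA, PA, a1, a2, a3, a4, a5, -⟩ := h.valley
  obtain ⟨UB, PB, b1, b2, b3, b4, b5, -⟩ := h.rot.valley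
  obtain ⟨UC, PC, c1, c2, c3, c4, c5, -⟩ := h.rot.rot.valley
  obtain ⟨UD, PD, d1, d2, d3, d4, d5, -⟩ := h.rot.rot.rot.valley
  simp at b1 b2 b3 b4 b5 c1 c2 c3 c4 c5 d1 d2 d3 d4 d5
  have hx := τ.hx
  have hy := τ.hy
  have Ax : τ.x₁ A < ℓ := lt_of_le_of_ne (τ.x₁_le A) fun h => τ.not_span_x ax h
  have Dx : τ.x₁ D < ℓ := lt_of_le_of_ne (τ.x₁_le D) fun h => τ.not_span_x dx h
  have Bx : 0 < τ.x₀ B := lt_of_le_of_ne (τ.x₀_nonneg B) fun h => τ.not_span_x h.symm bx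
  have Cx : 0 < τ.x₀ C := lt_of_le_of_ne (τ.x₀_nonneg C) fun h => τ.not_span_x h.symm cx
  have Ay : 0 < τ.y₀ A := lt_of_le_of_ne (τ.y₀_nonneg A) fun h => τ.not_span_y h.symm ay
  have By : 0 < τ.y₀ B := lt_of_le_of_ne (τ.y₀_nonneg B) fun h => τ.not_span_y h.symm by'
  have Cy : τ.y₁ C < ℓ := lt_of_le_of_ne (τ.y₁_le C) fun h => τ.not_span_y cy h
  have Dy : τ.y₁ D < ℓ := lt_of_le_of_ne (τ.y₁_le D) fun h => τ.not_span_y dy h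
  have hxA := hx A; have hxB := hx B; have hxC := hx C; have hxD := hx D
  have hyA := hy A; have hyB := hy B; have hyC := hy C; have hyD := hy D
  have cases4 : ∀ i, (τ.x₀ i = 0 ∨ τ.x₁ i = ℓ ∨ τ.y₀ i = 0 ∨ τ.y₁ i = ℓ) →
      i = A ∨ i = B ∨ i = C ∨ i = D := fun i hi => by
    by_contra! h'
    obtain ⟨p, q, r, s⟩ := H i h'.1 h'.2.1 h'.2.2.1 h'.2.2.2
    -- Only corner tiles touch the boundary, so each valley tile `UA`, `UB`, `UC`, `UD` is the next
    -- corner tile.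
    rcases hi with hi | hi | hi | hi <;> contradiction
  have eDA : τ.y₁ D = τ.y₀ A := by
    rcases cases4 UA (by simp [a1]) with rfl | rfl | rfl | rfl <;> linarith
  have eAB : τ.x₁ A = τ.x₀ B := by
    rcases cases4 UB (by right; right; right; linarith) with rfl | rfl | rfl | rfl <;> linarith
  have eBC : τ.y₀ B = τ.y₁ C := by
    rcases cases4 UC (by right; left; linarith) with rfl | rfl | rfl | rfl <;> linarith
  have eCD : τ.x₀ C = τ.x₁ D := by
    rcases cases4 UD (by right; right; left; linarith) with rfl | rfl | rfl | rfl <;> linarith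
  have lx : τ.x₁ D < τ.x₁ A := lt_of_le_of_ne (dmin A ax) fun h' =>
    τ.not_stacked (i := A) (j := D) (by linarith) h'.symm eDA
  have ly : τ.y₁ C < τ.y₁ D := lt_of_le_of_ne (cmin D dy) fun h' =>
    τ.not_side_by_side (i := C) (j := D) (by linarith) h' eCD.symm
  obtain ⟨i, hi⟩ := τ.exists_not_mem [A, B, C, D] (by simp)
  obtain ⟨j, hj⟩ := τ.exists_not_mem [A, B, C, D, i] (by simp)
  simp at hi hj
  have inside : ∀ k, k ≠ A → k ≠ B → k ≠ C → k ≠ D →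
      τ.x₁ D ≤ τ.x₀ k ∧ τ.x₁ k ≤ τ.x₀ B ∧ τ.y₁ C ≤ τ.y₀ k ∧ τ.y₁ k ≤ τ.y₀ A := by
    intro k kA kB kC kD
    obtain ⟨p, q, r, s⟩ := H k kA kB kC kD
    have hxk := hx k; have hyk := hy k
    have := τ.x₀_nonneg k; have := τ.x₁_le k; have := τ.y₀_nonneg k; have := τ.y₁_le k
    have oA : τ.x₁ A ≤ τ.x₀ k ∨ τ.y₁ k ≤ τ.y₀ A := by
      by_contra! h'
      exact kA (by apply τ.eq_of_overlap <;> linarith [h'.1, h'.2])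
    have oB : τ.x₁ k ≤ τ.x₀ B ∨ τ.y₁ k ≤ τ.y₀ B := by
      by_contra! h'
      exact kB (by apply τ.eq_of_overlap <;> linarith [h'.1, h'.2])
    have oC : τ.x₁ k ≤ τ.x₀ C ∨ τ.y₁ C ≤ τ.y₀ k := by
      by_contra! h'
      exact kC (by apply τ.eq_of_overlap <;> linarith [h'.1, h'.2])
    have oD : τ.x₁ D ≤ τ.x₀ k ∨ τ.y₁ D ≤ τ.y₀ k := by
      by_contra! h'
      exact kD (by apply τ.eq_of_overlap <;> linarith [h'.1, h'.2])
    rcases oA with oA | oA <;> rcases oB with oB | oB <;> rcases oC with oC | oC <;>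
      rcases oD with oD | oD <;> first | exact ⟨oD, oB, oC, oA⟩ | (exfalso; linarith)
  -- The corner tiles surround a box that contains all other tiles, at least two, but not `A`.
  have := τ.proper (τ.x₁ D) (τ.x₀ B) (τ.y₁ C) (τ.y₀ A) (by linarith) (by linarith) (by linarith)
    (by linarith) (by linarith) (by linarith) (fun k => by
      by_cases kA : k = A
      · simp [kA]
      by_cases kB : k = B
      · simp [kB]
      by_cases kC : k = C
      · simp [kC]
      by_cases kD : k = D
      · simp [kD]
      exact Or.inl (inside k kA kB kC kD)) i j (Ne.symm hj.2.2.2.2)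
    (inside i hi.1 hi.2.1 hi.2.2.1 hi.2.2.2) (inside j hj.1 hj.2.1 hj.2.2.1 hj.2.2.2.1) A
  linarith [this.1]

/-- The tiles as sets. -/
def tile (τ : EquiTiling ι ℓ) (i : ι) : Set Plane := box (τ.x₀ i) (τ.x₁ i) (τ.y₀ i) (τ.y₁ i)

set_option maxHeartbeats 2000000 in
/-- A pinwheel with a further tile on the left side is a spiral. -/
theorem IsPinwheel.range_tile_eq {E : ι} (h : τ.IsPinwheel A B C D) (hE : τ.x₀ E = 0)
    (nEA : E ≠ A) (nED : E ≠ D) : ∃ x₁ x₂ x₃ y₁ y₂ y₃ : ℝ,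
      0 < x₁ ∧ x₁ < x₂ ∧ x₂ < x₃ ∧ x₃ < ℓ ∧ 0 < y₁ ∧ y₁ < y₂ ∧ y₂ < y₃ ∧ y₃ < ℓ ∧
      range τ.tile = spiralTiles ℓ x₁ x₂ x₃ y₁ y₂ y₃ := by
  have ⟨ax, ay, bx, by', cx, cy, dx, dy, amin, bmin, cmin, dmin⟩ := h
  obtain ⟨UA, G, a1, a2, a3, a4, a5, a6, a7, a8, a9⟩ := h.valley
  obtain ⟨UB, PB, b1, b2, b3, b4, b5, b6, b7, b8, b9⟩ := h.rot.valley
  obtain ⟨UC, PC, c1, c2, c3, c4, c5, c6, c7, c8, c9⟩ := h.rot.rot.valley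
  obtain ⟨UD, F, d1, d2, d3, d4, d5, d6, d7, d8, d9⟩ := h.rot.rot.rot.valley
  simp at b1 b2 b3 b4 b5 b6 b7 b8 b9 c1 c2 c3 c4 c5 c6 c7 c8 c9 d1 d2 d3 d4 d5 d6 d7 d8 d9
  have hx := τ.hx
  have hy := τ.hy
  have Ax : τ.x₁ A < ℓ := lt_of_le_of_ne (τ.x₁_le A) fun h => τ.not_span_x ax h
  have Dx : τ.x₁ D < ℓ := lt_of_le_of_ne (τ.x₁_le D) fun h => τ.not_span_x dx h
  have Ex : τ.x₁ E < ℓ := lt_of_le_of_ne (τ.x₁_le E) fun h => τ.not_span_x hE h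
  have Bx : 0 < τ.x₀ B := lt_of_le_of_ne (τ.x₀_nonneg B) fun h => τ.not_span_x h.symm bx
  have Cx : 0 < τ.x₀ C := lt_of_le_of_ne (τ.x₀_nonneg C) fun h => τ.not_span_x h.symm cx
  have Ay : 0 < τ.y₀ A := lt_of_le_of_ne (τ.y₀_nonneg A) fun h => τ.not_span_y h.symm ay
  have By : 0 < τ.y₀ B := lt_of_le_of_ne (τ.y₀_nonneg B) fun h => τ.not_span_y h.symm by'
  have Cy : τ.y₁ C < ℓ := lt_of_le_of_ne (τ.y₁_le C) fun h => τ.not_span_y cy h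
  have Dy : τ.y₁ D < ℓ := lt_of_le_of_ne (τ.y₁_le D) fun h => τ.not_span_y dy h
  have hxA := hx A; have hxB := hx B; have hxC := hx C; have hxD := hx D
  have hxE := hx E; have hxF := hx F; have hxG := hx G
  have hyA := hy A; have hyB := hy B; have hyC := hy C; have hyD := hy D
  have hyE := hy E; have hyF := hy F; have hyG := hy G
  have E0 := τ.y₀_nonneg E
  have lCD := cmin D dy
  have E1 := τ.y₁_le E
  have lAE : τ.y₁ E ≤ τ.y₀ A := by
    by_contra! h
    exact nEA (by apply τ.eq_of_overlap <;> linarith)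
  have lDE : τ.y₁ D ≤ τ.y₀ E := by
    by_contra! h
    exact nED (by apply τ.eq_of_overlap <;> linarith)
  have nAB : A ≠ B := by rintro rfl; linarith
  have nAC : A ≠ C := by rintro rfl; linarith
  have nAD : A ≠ D := by rintro rfl; linarith
  have nAE : A ≠ E := nEA.symm
  have nAF : A ≠ F := by rintro rfl; linarith
  have nAG : A ≠ G := by rintro rfl; linarith
  have nBC : B ≠ C := by rintro rfl; linarith
  have nBD : B ≠ D := by rintro rfl; linarith
  have nBE : B ≠ E := by rintro rfl; linarith
  have nBF : B ≠ F := by rintro rfl; linarith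
  have nBG : B ≠ G := by rintro rfl; linarith
  have nCD : C ≠ D := by rintro rfl; linarith
  have nCE : C ≠ E := by rintro rfl; linarith
  have nCF : C ≠ F := by rintro rfl; linarith
  have nCG : C ≠ G := by rintro rfl; linarith
  have nDE : D ≠ E := nED.symm
  have nDF : D ≠ F := by rintro rfl; linarith
  have nDG : D ≠ G := by rintro rfl; linarith
  have nEF : E ≠ F := by rintro rfl; linarith
  have nEG : E ≠ G := by rintro rfl; linarith
  have nFG : F ≠ G := by rintro rfl; linarith
  -- `F` and `G` touch no side of the square and end at different heights, hence they are distinct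
  -- and complete the list.
  have all : ∀ i, i = A ∨ i = B ∨ i = C ∨ i = D ∨ i = E ∨ i = F ∨ i = G := fun i => by
    simpa using τ.mem_of_nodup [A, B, C, D, E, F, G] (by simp [*]) rfl i
  have eCD : τ.x₀ C = τ.x₁ D := by
    rcases all UD with rfl | rfl | rfl | rfl | rfl | rfl | rfl <;> linarith
  have eBC : τ.y₀ B = τ.y₁ C := by
    rcases all UC with rfl | rfl | rfl | rfl | rfl | rfl | rfl <;> linarith
  have eAB : τ.x₁ A = τ.x₀ B := by
    rcases all UB with rfl | rfl | rfl | rfl | rfl | rfl | rfl <;> linarith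
  have eUA : UA = E := by
    rcases all UA with rfl | rfl | rfl | rfl | rfl | rfl | rfl <;> first | rfl | linarith
  subst eUA
  have eE : τ.y₀ UA = τ.y₁ D := by
    obtain ⟨K, k1, k2, k3, k4⟩ := τ.se 0 (τ.y₀ UA) le_rfl τ.pos (by linarith) (by linarith)
    rcases all K with rfl | rfl | rfl | rfl | rfl | rfl | rfl <;> linarith
  -- `D` is the narrowest tile on the left, and no two widths agree.
  have lDE' : τ.x₁ D < τ.x₁ UA :=
    lt_of_le_of_ne (dmin _ hE) fun h' => nED (τ.width_inj _ _ (by linarith))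
  have hG : τ.x₀ G = τ.x₁ UA := by
    refine le_antisymm ?_ a3
    obtain ⟨K, k1, k2, k3, k4⟩ := τ.se (τ.x₁ UA) (τ.y₀ A) (by linarith) (by linarith)
      (by linarith) (by linarith)
    rcases all K with rfl | rfl | rfl | rfl | rfl | rfl | rfl <;> linarith
  have ePC : PC = F := by
    rcases all PC with rfl | rfl | rfl | rfl | rfl | rfl | rfl <;> first | rfl | linarith
  subst ePC
  -- The inner tile in the corner of `B` and `C` is `F` or `G`. If it were `F`, then `F` would
  -- extend to `B` below `G`, and `G` would start at the level of `D`, forming a rectangle with the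
  -- left tile `UA`.
  have ePB : PB = G := by
    rcases all PB with rfl | rfl | rfl | rfl | rfl | rfl | rfl <;> try first | rfl | linarith
    have lG : τ.y₁ D ≤ τ.y₀ G := by
      by_contra! h
      exact nFG (by apply τ.eq_of_overlap <;> linarith)
    obtain ⟨K, k1, k2, k3, k4⟩ := τ.nw (τ.x₀ B) (τ.y₁ D) (by linarith) (by linarith)
      (by linarith) (by linarith)
    exact absurd (τ.not_side_by_side (i := G) (j := UA) (by
      rcases all K with rfl | rfl | rfl | rfl | rfl | rfl | rfl <;> linarith) (by linarith)
      hG.symm) id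
  subst ePB
  have hF : τ.x₁ PC = τ.x₁ UA := by
    have l : τ.x₁ PC ≤ τ.x₀ PB := by
      by_contra! h
      exact nFG (by apply τ.eq_of_overlap <;> linarith)
    obtain ⟨K, k1, k2, k3, k4⟩ := τ.ne (τ.x₁ PC) (τ.y₁ C) (by linarith) (by linarith)
      (by linarith) (by linarith)
    rcases all K with rfl | rfl | rfl | rfl | rfl | rfl | rfl <;> linarith
  refine ⟨τ.x₁ D, τ.x₁ UA, τ.x₁ A, τ.y₁ C, τ.y₁ D, τ.y₀ A, by linarith, lDE', by linarith, Ax,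
    by linarith, by linarith, by linarith, by linarith, ?_⟩
  have tA : τ.tile A = box 0 (τ.x₁ A) (τ.y₀ A) ℓ := by rw [tile, ax, ay]
  have tB : τ.tile B = box (τ.x₁ A) ℓ (τ.y₁ C) ℓ := by rw [tile, bx, by', eAB, eBC]
  have tC : τ.tile C = box (τ.x₁ D) ℓ 0 (τ.y₁ C) := by rw [tile, cx, cy, eCD]
  have tD : τ.tile D = box 0 (τ.x₁ D) 0 (τ.y₁ D) := by rw [tile, dx, dy]
  have tE : τ.tile UA = box 0 (τ.x₁ UA) (τ.y₁ D) (τ.y₀ A) := by rw [tile, hE, eE, a2]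
  have tG : τ.tile PB = box (τ.x₁ UA) (τ.x₁ A) (τ.y₁ C) (τ.y₀ A) := by
    rw [tile, hG, a4, a5, show τ.y₀ PB = τ.y₁ C by linarith]
  have tF : τ.tile PC = box (τ.x₁ D) (τ.x₁ UA) (τ.y₁ C) (τ.y₁ D) := by
    rw [tile, hF, show τ.x₀ PC = τ.x₁ D by linarith, show τ.y₀ PC = τ.y₁ C by linarith,
      show τ.y₁ PC = τ.y₁ D by linarith]
  rw [spiralTiles, ← tA, ← tB, ← tC, ← tD, ← tE, ← tF, ← tG]
  ext X
  simp only [mem_range, mem_insert_iff, mem_singleton_iff]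
  constructor
  · rintro ⟨i, rfl⟩
    rcases all i with rfl | rfl | rfl | rfl | rfl | rfl | rfl <;> simp
  · rintro (rfl | rfl | rfl | rfl | rfl | rfl | rfl) <;> exact ⟨_, rfl⟩

end EquiTiling

/-! ### Boxes as sets, and transport along isometries -/

open Filter Topology

theorem mem_box {x₀ x₁ y₀ y₁ : ℝ} {p : Plane} :
    p ∈ box x₀ x₁ y₀ y₁ ↔ (x₀ ≤ p 0 ∧ p 0 ≤ x₁) ∧ y₀ ≤ p 1 ∧ p 1 ≤ y₁ := Iff.rfl

theorem box_eq_preimage (x₀ x₁ y₀ y₁ : ℝ) :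
    box x₀ x₁ y₀ y₁ = EuclideanSpace.equiv (Fin 2) ℝ ⁻¹'
      (univ.pi fun i => Icc (![x₀, y₀] i) (![x₁, y₁] i)) := by
  ext p
  simp [mem_box, Pi.le_def, Fin.forall_fin_two]
  tauto

theorem interior_box (x₀ x₁ y₀ y₁ : ℝ) : interior (box x₀ x₁ y₀ y₁) =
    {p | (x₀ < p 0 ∧ p 0 < x₁) ∧ y₀ < p 1 ∧ p 1 < y₁} := by
  rw [box_eq_preimage]
  have h := (EuclideanSpace.equiv (Fin 2) ℝ).toHomeomorph.preimage_interior
    (univ.pi fun i => Icc (![x₀, y₀] i) (![x₁, y₁] i))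
  refine h.symm.trans ?_
  rw [interior_pi_set finite_univ]
  ext p
  simp [Fin.forall_fin_two]

theorem volume_box (x₀ x₁ y₀ y₁ : ℝ) :
    volume (box x₀ x₁ y₀ y₁) = ENNReal.ofReal (x₁ - x₀) * ENNReal.ofReal (y₁ - y₀) := by
  have h : box x₀ x₁ y₀ y₁ = (WithLp.ofLp : Plane → Fin 2 → ℝ) ⁻¹' Icc ![x₀, y₀] ![x₁, y₁] := by
    ext p
    simp [mem_box, Pi.le_def, Fin.forall_fin_two]
    tauto
  rw [h, (PiLp.volume_preserving_ofLp (Fin 2)).measure_preimage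
    measurableSet_Icc.nullMeasurableSet, Real.volume_Icc_pi]
  simp

/-- An isometry of the plane is a linear isometry followed by a translation, and both preserve
volume. -/
theorem volume_image (e : Plane ≃ᵢ Plane) (A : Set Plane) : volume (e '' A) = volume A := by
  have h : MeasurePreserving e.symm volume volume := by
    have h1 : (e.symm : Plane → Plane) =
        (fun x => x + e.symm 0) ∘ e.symm.toRealLinearIsometryEquiv := by
      ext1 x
      simp [IsometryEquiv.toRealLinearIsometryEquiv_apply]
    rw [h1]
    exact (measurePreserving_add_right volume _).comp (LinearIsometryEquiv.measurePreserving _)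
  rw [← e.preimage_symm]
  exact h.measure_preimage_emb e.symm.toHomeomorph.measurableEmbedding A

theorem HasSides.image {A : Set Plane} {a b : ℝ} (h : HasSides A a b) (e : Plane ≃ᵢ Plane) :
    HasSides (e '' A) a b := by
  obtain ⟨ha, hb, f, rfl⟩ := h
  exact ⟨ha, hb, f.trans e, by rw [image_image]; rfl⟩

theorem HasSides.of_image {A : Set Plane} {a b : ℝ} {e : Plane ≃ᵢ Plane}
    (h : HasSides (e '' A) a b) : HasSides A a b := by
  have := h.image e.symm
  rwa [← image_comp, e.symm_comp_self, image_id] at this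

theorem IsRectangle.image {A : Set Plane} (h : IsRectangle A) (e : Plane ≃ᵢ Plane) :
    IsRectangle (e '' A) := by
  obtain ⟨a, b, h⟩ := h
  exact ⟨a, b, h.image e⟩

theorem IsRectangle.of_image {A : Set Plane} {e : Plane ≃ᵢ Plane} (h : IsRectangle (e '' A)) :
    IsRectangle A := by
  obtain ⟨a, b, h⟩ := h
  exact ⟨a, b, h.of_image⟩

theorem sUnion_mapPartition (e : Plane ≃ᵢ Plane) (P : Set (Set Plane)) :
    ⋃₀ mapPartition e P = e '' ⋃₀ P := by
  rw [mapPartition, sUnion_image, image_sUnion]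
  simp

theorem mapPartition_trans (e f : Plane ≃ᵢ Plane) (P : Set (Set Plane)) :
    mapPartition f (mapPartition e P) = mapPartition (e.trans f) P := by
  simp only [mapPartition, image_image]
  rfl

theorem mapPartition_refl (P : Set (Set Plane)) :
    mapPartition (IsometryEquiv.refl Plane) P = P := by
  have : (fun A : Set Plane => (IsometryEquiv.refl Plane) '' A) = id := by
    ext1 A
    exact image_id A
  rw [mapPartition, this, image_id]

theorem mapPartition_symm (e : Plane ≃ᵢ Plane) (P : Set (Set Plane)) :
    mapPartition e.symm (mapPartition e P) = P := by
  simp [mapPartition, image_image]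

theorem IsProperPerfectMondrian.image {k : ℕ} {S : Set Plane} {P : Set (Set Plane)}
    (h : IsProperPerfectMondrian k S P) (e : Plane ≃ᵢ Plane) :
    IsProperPerfectMondrian k (e '' S) (mapPartition e P) := by
  have inj : Function.Injective (fun A : Set Plane => e '' A) := e.injective.image_injective
  refine ⟨⟨h.isPartition.two_le, h.isPartition.finite.image _, ?_, ?_, ?_, ?_⟩, ?_, ?_, ?_⟩
  · exact (ncard_image_of_injective _ inj).trans h.isPartition.ncard_eq
  · rintro _ ⟨A, hA, rfl⟩
    exact (h.isPartition.isRectangle A hA).image e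
  · rintro _ ⟨A, hA, rfl⟩ _ ⟨B, hB, rfl⟩ hAB
    have hd := h.isPartition.disjoint hA hB (fun h => hAB (by rw [h]))
    have hi (X : Set Plane) : interior (e '' X) = e '' interior X :=
      (e.toHomeomorph.image_interior X).symm
    simp only [hi]
    exact (disjoint_image_iff e.injective).2 hd
  · rw [sUnion_mapPartition, h.isPartition.sUnion_eq]
  · rintro _ ⟨A, hA, rfl⟩ _ ⟨B, hB, rfl⟩ hAB ⟨a, b, h1, h2⟩
    exact h.isMondrian hA hB (fun h => hAB (by rw [h])) ⟨a, b, h1.of_image, h2.of_image⟩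
  · rintro _ ⟨A, hA, rfl⟩
    simp only [volume_image]
    exact h.isPerfect A hA
  · intro Q hQ h1 h2 hR
    obtain ⟨Q, hQP, rfl⟩ := subset_image_iff.1 hQ
    rw [ncard_image_of_injective _ inj] at h1 h2
    refine h.isProper Q hQP h1 h2 (IsRectangle.of_image (e := e) ?_)
    rw [← sUnion_mapPartition]
    exact hR

theorem IsSpiral.image {S : Set Plane} {P : Set (Set Plane)} (h : IsSpiral S P)
    (e : Plane ≃ᵢ Plane) : IsSpiral (e '' S) (mapPartition e P) := by
  obtain ⟨f, ℓ, x₁, x₂, x₃, y₁, y₂, y₃, h1, h2, h3, h4, h5, h6, h7, h8, rfl, rfl⟩ := h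
  refine ⟨f.trans e, ℓ, x₁, x₂, x₃, y₁, y₂, y₃, h1, h2, h3, h4, h5, h6, h7, h8, ?_, ?_⟩
  · rw [image_image]; rfl
  · rw [mapPartition_trans]

/-- The reflection `(x, y) ↦ (y, x)`. -/
noncomputable def swapIso : Plane ≃ᵢ Plane :=
  IsometryEquiv.mk' (fun p => !₂[p 1, p 0]) (fun p => !₂[p 1, p 0])
    (fun p => by ext i; fin_cases i <;> simp)
    (Isometry.of_dist_eq fun p q => by
      simp [EuclideanSpace.dist_eq, add_comm])

/-- The reflection `(x, y) ↦ (ℓ - x, y)`. -/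
noncomputable def flipIso (ℓ : ℝ) : Plane ≃ᵢ Plane :=
  IsometryEquiv.mk' (fun p => !₂[ℓ - p 0, p 1]) (fun p => !₂[ℓ - p 0, p 1])
    (fun p => by ext i; fin_cases i <;> simp)
    (Isometry.of_dist_eq fun p q => by
      simp only [EuclideanSpace.dist_eq, Fin.sum_univ_two, Real.dist_eq, sq_abs]
      congr 1
      simp
      ring)

theorem swapIso_apply (p : Plane) : swapIso p = !₂[p 1, p 0] := rfl

theorem flipIso_apply (ℓ : ℝ) (p : Plane) : flipIso ℓ p = !₂[ℓ - p 0, p 1] := rfl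

theorem swapIso_image_box (x₀ x₁ y₀ y₁ : ℝ) :
    swapIso '' box x₀ x₁ y₀ y₁ = box y₀ y₁ x₀ x₁ := by
  ext p
  constructor
  · rintro ⟨q, hq, rfl⟩
    simpa [swapIso_apply, mem_box, and_comm] using hq
  · intro hp
    refine ⟨!₂[p 1, p 0], by simpa [mem_box, and_comm] using hp, ?_⟩
    ext i; fin_cases i <;> simp [swapIso_apply]

theorem flipIso_image_box (ℓ x₀ x₁ y₀ y₁ : ℝ) :
    flipIso ℓ '' box x₀ x₁ y₀ y₁ = box (ℓ - x₁) (ℓ - x₀) y₀ y₁ := by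
  ext p
  constructor
  · rintro ⟨q, ⟨⟨h1, h2⟩, h3⟩, rfl⟩
    simp only [flipIso_apply, mem_box]
    exact ⟨⟨by simp; linarith, by simp; linarith⟩, h3⟩
  · rintro ⟨⟨h1, h2⟩, h3⟩
    refine ⟨!₂[ℓ - p 0, p 1], ⟨⟨?_, ?_⟩, ?_⟩, ?_⟩
    · simp; linarith
    · simp; linarith
    · simpa using h3
    · ext i; fin_cases i <;> simp [flipIso_apply]

theorem hasSides_box {x₀ x₁ y₀ y₁ : ℝ} (hx : x₀ < x₁) (hy : y₀ < y₁) :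
    HasSides (box x₀ x₁ y₀ y₁) (x₁ - x₀) (y₁ - y₀) := by
  refine ⟨sub_pos.2 hx, sub_pos.2 hy, IsometryEquiv.addRight !₂[x₀, y₀], ?_⟩
  ext p
  constructor
  · rintro ⟨⟨h1, h2⟩, h3, h4⟩
    refine ⟨p - !₂[x₀, y₀], ?_, by simp⟩
    simp [mem_box, *]
  · rintro ⟨q, ⟨⟨h1, h2⟩, h3, h4⟩, rfl⟩
    simp only [mem_box, IsometryEquiv.addRight_apply, PiLp.add_apply]
    simp
    exact ⟨⟨h1, by linarith⟩, h3, by linarith⟩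

theorem convex_box (x₀ x₁ y₀ y₁ : ℝ) : Convex ℝ (box x₀ x₁ y₀ y₁) := by
  rw [box_eq_preimage]
  exact (convex_pi fun i _ => convex_Icc _ _).linear_preimage
    (EuclideanSpace.equiv (Fin 2) ℝ).toLinearMap

theorem isClosed_box (x₀ x₁ y₀ y₁ : ℝ) : IsClosed (box x₀ x₁ y₀ y₁) := by
  rw [box_eq_preimage]
  exact (isClosed_set_pi fun i _ => isClosed_Icc).preimage (EuclideanSpace.equiv (Fin 2) ℝ).continuous

theorem closure_interior_box {x₀ x₁ y₀ y₁ : ℝ} (hx : x₀ < x₁) (hy : y₀ < y₁) :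
    closure (interior (box x₀ x₁ y₀ y₁)) = box x₀ x₁ y₀ y₁ := by
  rw [(convex_box x₀ x₁ y₀ y₁).closure_interior_eq_closure_of_nonempty_interior,
    (isClosed_box _ _ _ _).closure_eq]
  refine ⟨!₂[(x₀ + x₁) / 2, (y₀ + y₁) / 2], ?_⟩
  rw [interior_box]
  refine ⟨⟨?_, ?_⟩, ?_, ?_⟩ <;> simp <;> linarith

/-! ### The classification, up to symmetry -/

namespace EquiTiling

variable {ι : Type} {ℓ : ℝ} (τ : EquiTiling ι ℓ)

/-- `IsSpiral` allows every isometry, reflections included, so the tiling may be replaced by a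
mirror image. -/
theorem isSpiral_of_flipX (h : IsSpiral (box 0 ℓ 0 ℓ) (range τ.flipX.tile)) :
    IsSpiral (box 0 ℓ 0 ℓ) (range τ.tile) := by
  convert h.image (flipIso ℓ) using 1
  · simp [flipIso_image_box]
  · rw [mapPartition, ← range_comp]
    congr 1
    ext1 i
    simp [tile, flipIso_image_box]

theorem isSpiral_of_swap (h : IsSpiral (box 0 ℓ 0 ℓ) (range τ.swap.tile)) :
    IsSpiral (box 0 ℓ 0 ℓ) (range τ.tile) := by
  convert h.image swapIso using 1
  · simp [swapIso_image_box]
  · rw [mapPartition, ← range_comp]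
    congr 1
    ext1 i
    simp [tile, swapIso_image_box]

theorem isSpiral_of_rot (h : IsSpiral (box 0 ℓ 0 ℓ) (range τ.rot.tile)) :
    IsSpiral (box 0 ℓ 0 ℓ) (range τ.tile) :=
  τ.isSpiral_of_swap (τ.swap.isSpiral_of_flipX h)

variable {τ} {A B C D : ι}

theorem IsPinwheel.isSpiral_of_left {E : ι} (h : τ.IsPinwheel A B C D) (hE : τ.x₀ E = 0)
    (nEA : E ≠ A) (nED : E ≠ D) : IsSpiral (box 0 ℓ 0 ℓ) (range τ.tile) := by
  obtain ⟨x₁, x₂, x₃, y₁, y₂, y₃, h1, h2, h3, h4, h5, h6, h7, h8, h9⟩ :=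
    h.range_tile_eq hE nEA nED
  refine ⟨IsometryEquiv.refl _, ℓ, x₁, x₂, x₃, y₁, y₂, y₃, h1, h2, h3, h4, h5, h6, h7, h8, ?_, ?_⟩
  · exact (image_id _).symm
  · rw [h9]
    exact (mapPartition_refl _).symm

theorem IsPinwheel.isSpiral (h : τ.IsPinwheel A B C D) :
    IsSpiral (box 0 ℓ 0 ℓ) (range τ.tile) := by
  obtain ⟨E, eA, eB, eC, eD, hE⟩ := h.exists_middle
  rcases hE with hE | hE | hE | hE
  · exact h.isSpiral_of_left hE eA eD
  · exact τ.isSpiral_of_rot (τ.rot.isSpiral_of_rot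
      (h.rot.rot.isSpiral_of_left (E := E) (by simp [hE]) eC eB))
  · exact τ.isSpiral_of_rot (τ.rot.isSpiral_of_rot (τ.rot.rot.isSpiral_of_rot
      (h.rot.rot.rot.isSpiral_of_left (E := E) (by simp [hE]) eD eC)))
  · exact τ.isSpiral_of_rot (h.rot.isSpiral_of_left (E := E) (by simp [hE]) eB eA)

/-- The narrowest tile on the left lies in a corner. It is not `A`, as the valley below `A` contains
a narrower tile on the left side; so it is at the bottom left. The same argument passes on to the
bottom and then to the right side, and gives a pinwheel. -/
theorem isSpiral_of_topLeft (τ : EquiTiling ι ℓ) (ax : τ.x₀ A = 0) (ay : τ.y₁ A = ℓ)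
    (amin : ∀ j, τ.y₁ j = ℓ → τ.y₀ j ≤ τ.y₀ A) : IsSpiral (box 0 ℓ 0 ℓ) (range τ.tile) := by
  obtain ⟨D, dx, dmin⟩ := τ.exists_narrowest_left
  obtain ⟨C, cy, cmin⟩ := τ.exists_shallowest_bottom
  obtain ⟨B, bx, bmin⟩ := τ.exists_narrowest_right
  have hD : τ.y₀ D = 0 := by
    by_contra h0
    have h0 := lt_of_le_of_ne (τ.y₀_nonneg D) (Ne.symm h0)
    rcases (τ.y₁_le D).eq_or_lt with h1 | h1
    · obtain rfl := τ.eq_topLeft ax ay dx h1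
      obtain ⟨U, V, u1, u2, u3, u4, u5⟩ := τ.valley_top ay amin
      linarith [dmin U (by linarith), τ.hx V]
    · exact τ.narrowest_left_in_corner dx dmin h0 h1
  have hC : τ.x₁ C = ℓ := by
    by_contra h0
    have h0 := lt_of_le_of_ne (τ.x₁_le C) h0
    rcases (τ.x₀_nonneg C).eq_or_lt with h1 | h1
    · obtain rfl := τ.eq_bottomLeft dx hD h1.symm cy
      obtain ⟨U, V, u1, u2, u3, u4, u5⟩ := τ.valley_left dx dmin
      linarith [cmin V (by linarith), τ.hy U]
    · exact τ.swap.narrowest_left_in_corner (E := C) cy cmin h1 h0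
  have hB : τ.y₁ B = ℓ := by
    by_contra h0
    have h0 := lt_of_le_of_ne (τ.y₁_le B) h0
    rcases (τ.y₀_nonneg B).eq_or_lt with h1 | h1
    · obtain rfl := τ.eq_bottomRight hC cy bx h1.symm
      obtain ⟨U, V, u1, u2, u3, u4, u5⟩ := τ.valley_bottom cy cmin
      linarith [bmin V (by linarith), τ.hx U]
    · refine τ.flipX.narrowest_left_in_corner (E := B) (by simp [bx]) (fun j hj => ?_) h1 h0
      simp at hj ⊢
      linarith [bmin j (by linarith)]
  exact IsPinwheel.isSpiral (τ := τ) ⟨ax, ay, bx, hB, hC, cy, dx, hD, amin, bmin, cmin, dmin⟩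

/-- The classification in coordinates. -/
theorem isSpiral (τ : EquiTiling ι ℓ) : IsSpiral (box 0 ℓ 0 ℓ) (range τ.tile) := by
  obtain ⟨A, ay, amin⟩ := τ.exists_shallowest_top
  rcases (τ.x₀_nonneg A).eq_or_lt with h0 | h0
  · exact τ.isSpiral_of_topLeft h0.symm ay amin
  rcases (τ.x₁_le A).eq_or_lt with h1 | h1
  · exact τ.isSpiral_of_flipX (τ.flipX.isSpiral_of_topLeft (A := A) (by simp [h1]) ay amin)
  · refine (τ.rot.narrowest_left_in_corner (E := A) (by simp [ay]) (fun j hj => ?_) h0 h1).elim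
    simp at hj ⊢
    linarith [amin j (by linarith)]

end EquiTiling

/-! ### Rotated frames, and why the tiles are axis-parallel -/

/-- The rectangle `[u₀, u₁] × [v₀, v₁]` in the coordinates with axes `(c, s)` and `(-s, c)`. -/
def obox (c s u₀ u₁ v₀ v₁ : ℝ) : Set Plane :=
  {p | (u₀ ≤ c * p 0 + s * p 1 ∧ c * p 0 + s * p 1 ≤ u₁) ∧
    v₀ ≤ -s * p 0 + c * p 1 ∧ -s * p 0 + c * p 1 ≤ v₁}

theorem mem_obox {c s u₀ u₁ v₀ v₁ : ℝ} {p : Plane} : p ∈ obox c s u₀ u₁ v₀ v₁ ↔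
    (u₀ ≤ c * p 0 + s * p 1 ∧ c * p 0 + s * p 1 ≤ u₁) ∧
      v₀ ≤ -s * p 0 + c * p 1 ∧ -s * p 0 + c * p 1 ≤ v₁ := Iff.rfl

/-- Together with `obox_rot`: the frame of a rectangle matters only up to quarter turns. -/
theorem obox_neg (c s u₀ u₁ v₀ v₁ : ℝ) :
    obox (-c) (-s) u₀ u₁ v₀ v₁ = obox c s (-u₁) (-u₀) (-v₁) (-v₀) := by
  ext p
  simp only [mem_obox]
  constructor <;> rintro ⟨⟨h1, h2⟩, h3, h4⟩ <;> refine ⟨⟨?_, ?_⟩, ?_, ?_⟩ <;> linarith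

theorem obox_rot (c s u₀ u₁ v₀ v₁ : ℝ) :
    obox (-s) c u₀ u₁ v₀ v₁ = obox c s (-v₁) (-v₀) u₀ u₁ := by
  ext p
  simp only [mem_obox]
  constructor <;> rintro ⟨⟨h1, h2⟩, h3, h4⟩ <;> refine ⟨⟨?_, ?_⟩, ?_, ?_⟩ <;> linarith

theorem obox_one_zero (u₀ u₁ v₀ v₁ : ℝ) : obox 1 0 u₀ u₁ v₀ v₁ = box u₀ u₁ v₀ v₁ := by
  ext p
  simp [mem_obox, mem_box]

/-- The point with coordinates `u`, `v` in the frame with axes `(c, s)` and `(-s, c)`. -/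
noncomputable def frame (c s u v : ℝ) : Plane := !₂[c * u - s * v, s * u + c * v]

@[simp] theorem frame_zero (c s u v : ℝ) : frame c s u v 0 = c * u - s * v := rfl
@[simp] theorem frame_one (c s u v : ℝ) : frame c s u v 1 = s * u + c * v := rfl

theorem frame_fst {c s : ℝ} (h : c ^ 2 + s ^ 2 = 1) (u v : ℝ) :
    c * frame c s u v 0 + s * frame c s u v 1 = u := by
  simp; linear_combination u * h

theorem frame_snd {c s : ℝ} (h : c ^ 2 + s ^ 2 = 1) (u v : ℝ) :
    -s * frame c s u v 0 + c * frame c s u v 1 = v := by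
  simp; linear_combination v * h

theorem frame_mem_obox {c s : ℝ} (h : c ^ 2 + s ^ 2 = 1) {u₀ u₁ v₀ v₁ u v : ℝ} :
    frame c s u v ∈ obox c s u₀ u₁ v₀ v₁ ↔ (u₀ ≤ u ∧ u ≤ u₁) ∧ v₀ ≤ v ∧ v ≤ v₁ := by
  rw [mem_obox, frame_fst h, frame_snd h]

theorem isClosed_obox (c s u₀ u₁ v₀ v₁ : ℝ) : IsClosed (obox c s u₀ u₁ v₀ v₁) := by
  have hu : Continuous fun p : Plane => c * p 0 + s * p 1 := by fun_prop
  have hv : Continuous fun p : Plane => -s * p 0 + c * p 1 := by fun_prop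
  exact ((isClosed_le continuous_const hu).inter (isClosed_le hu continuous_const)).inter
    ((isClosed_le continuous_const hv).inter (isClosed_le hv continuous_const))

theorem convex_obox (c s u₀ u₁ v₀ v₁ : ℝ) : Convex ℝ (obox c s u₀ u₁ v₀ v₁) := by
  have h1 : IsLinearMap ℝ (fun p : Plane => c * p 0 + s * p 1) :=
    ⟨fun x y => by simp; ring, fun a x => by simp; ring⟩
  have h2 : IsLinearMap ℝ (fun p : Plane => -s * p 0 + c * p 1) :=
    ⟨fun x y => by simp; ring, fun a x => by simp; ring⟩
  exact ((convex_halfSpace_ge h1 _).inter (convex_halfSpace_le h1 _)).inter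
    ((convex_halfSpace_ge h2 _).inter (convex_halfSpace_le h2 _))

theorem mem_interior_obox {c s u₀ u₁ v₀ v₁ : ℝ} {p : Plane}
    (h1 : u₀ < c * p 0 + s * p 1) (h2 : c * p 0 + s * p 1 < u₁)
    (h3 : v₀ < -s * p 0 + c * p 1) (h4 : -s * p 0 + c * p 1 < v₁) :
    p ∈ interior (obox c s u₀ u₁ v₀ v₁) := by
  refine interior_maximal
    (s := obox c s u₀ u₁ v₀ v₁)
    (t := {p : Plane | (u₀ < c * p 0 + s * p 1 ∧ c * p 0 + s * p 1 < u₁) ∧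
      v₀ < -s * p 0 + c * p 1 ∧ -s * p 0 + c * p 1 < v₁})
    (fun q hq => ⟨⟨hq.1.1.le, hq.1.2.le⟩, hq.2.1.le, hq.2.2.le⟩) ?_ ⟨⟨h1, h2⟩, h3, h4⟩
  have hu : Continuous fun p : Plane => c * p 0 + s * p 1 := by fun_prop
  have hv : Continuous fun p : Plane => -s * p 0 + c * p 1 := by fun_prop
  exact ((isOpen_lt continuous_const hu).inter (isOpen_lt hu continuous_const)).inter
    ((isOpen_lt continuous_const hv).inter (isOpen_lt hv continuous_const))

theorem frame_mem_interior_obox {c s : ℝ} (h : c ^ 2 + s ^ 2 = 1) {u₀ u₁ v₀ v₁ u v : ℝ}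
    (h1 : u₀ < u) (h2 : u < u₁) (h3 : v₀ < v) (h4 : v < v₁) :
    frame c s u v ∈ interior (obox c s u₀ u₁ v₀ v₁) := by
  apply mem_interior_obox <;> simpa only [frame_fst h, frame_snd h]

theorem closure_interior_obox {c s : ℝ} (h : c ^ 2 + s ^ 2 = 1) {u₀ u₁ v₀ v₁ : ℝ}
    (hu : u₀ < u₁) (hv : v₀ < v₁) :
    closure (interior (obox c s u₀ u₁ v₀ v₁)) = obox c s u₀ u₁ v₀ v₁ := by
  rw [(convex_obox c s u₀ u₁ v₀ v₁).closure_interior_eq_closure_of_nonempty_interior,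
    (isClosed_obox _ _ _ _ _ _).closure_eq]
  exact ⟨_, frame_mem_interior_obox h (u := (u₀ + u₁) / 2) (v := (v₀ + v₁) / 2)
    (by linarith) (by linarith) (by linarith) (by linarith)⟩

/-- Every rectangle is a box in a suitable orthonormal frame. -/
theorem IsRectangle.exists_obox {A : Set Plane} (hA : IsRectangle A) :
    ∃ c s u₀ u₁ v₀ v₁ : ℝ, c ^ 2 + s ^ 2 = 1 ∧ u₀ < u₁ ∧ v₀ < v₁ ∧ A = obox c s u₀ u₁ v₀ v₁ := by
  obtain ⟨a, b, ha, hb, f, rfl⟩ := hA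
  set L := f.toRealLinearIsometryEquiv with hL
  have hf (x : Plane) : f x = x 0 • L (EuclideanSpace.single 0 1) +
      x 1 • L (EuclideanSpace.single 1 1) + f 0 := by
    have h1 : L x = f x - f 0 := f.toRealLinearIsometryEquiv_apply x
    have h2 : x = x 0 • (EuclideanSpace.single 0 1 : Plane) +
        x 1 • (EuclideanSpace.single 1 1 : Plane) := by
      ext i; fin_cases i <;> simp
    have h3 : f x = L x + f 0 := by rw [h1]; abel
    rw [h3]
    conv_lhs => rw [h2]
    simp
  set e := L (EuclideanSpace.single 0 1) with he
  set g := L (EuclideanSpace.single 1 1) with hg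
  have n1 : e 0 ^ 2 + e 1 ^ 2 = 1 := by
    have : ‖e‖ = 1 := by simp [he]
    rw [EuclideanSpace.norm_eq, Real.sqrt_eq_one] at this
    simpa [Fin.sum_univ_two] using this
  have n2 : g 0 ^ 2 + g 1 ^ 2 = 1 := by
    have : ‖g‖ = 1 := by simp [hg]
    rw [EuclideanSpace.norm_eq, Real.sqrt_eq_one] at this
    simpa [Fin.sum_univ_two] using this
  have n3 : e 0 * g 0 + e 1 * g 1 = 0 := by
    have : inner ℝ e g = (0 : ℝ) := by
      rw [he, hg, L.inner_map_map]
      simp [EuclideanSpace.inner_single_left]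
    simp [PiLp.inner_apply, Fin.sum_univ_two] at this
    linarith
  have hf0 (x : Plane) : f x 0 = x 0 * e 0 + x 1 * g 0 + f 0 0 := by rw [hf x]; simp
  have hf1 (x : Plane) : f x 1 = x 0 * e 1 + x 1 * g 1 + f 0 1 := by rw [hf x]; simp
  set c := e 0
  set s := e 1
  -- The determinant of the linear part, equal to 1 or -1. A reflection only reverses the second
  -- interval.
  set k := c * g 1 - s * g 0 with hk
  have hk2 : k ^ 2 = 1 := by
    rw [hk]
    linear_combination (g 0 ^ 2 + g 1 ^ 2) * n1 + n2 - (c * g 0 + s * g 1) * n3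
  have hu (x : Plane) : c * f x 0 + s * f x 1 = x 0 + (c * f 0 0 + s * f 0 1) := by
    rw [hf0, hf1]
    linear_combination x 0 * n1 + x 1 * n3
  have hv (x : Plane) : -s * f x 0 + c * f x 1 = k * x 1 + (-s * f 0 0 + c * f 0 1) := by
    rw [hf0, hf1, hk]
    ring
  set U := c * f 0 0 + s * f 0 1
  set V := -s * f 0 0 + c * f 0 1
  have himage (x : Plane) (v₀ v₁ : ℝ) (h : (v₀ ≤ k * x 1 + V ∧ k * x 1 + V ≤ v₁) ↔
      (0 ≤ x 1 ∧ x 1 ≤ b)) : f x ∈ obox c s U (U + a) v₀ v₁ ↔ x ∈ box 0 a 0 b := by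
    rw [mem_obox, mem_box, hu, hv, h]
    constructor
    · rintro ⟨⟨h1, h2⟩, h3⟩
      exact ⟨⟨by linarith, by linarith⟩, h3⟩
    · rintro ⟨⟨h1, h2⟩, h3⟩
      exact ⟨⟨by linarith, by linarith⟩, h3⟩
  have hset (v₀ v₁ : ℝ) (h : ∀ x : Plane, (v₀ ≤ k * x 1 + V ∧ k * x 1 + V ≤ v₁) ↔
      (0 ≤ x 1 ∧ x 1 ≤ b)) : f '' box 0 a 0 b = obox c s U (U + a) v₀ v₁ := by
    ext p
    constructor
    · rintro ⟨x, hx, rfl⟩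
      exact (himage x _ _ (h x)).2 hx
    · intro hp
      refine ⟨f.symm p, (himage _ v₀ v₁ (h _)).1 (by simpa using hp), by simp⟩
  rcases sq_eq_sq_iff_eq_or_eq_neg.1 (hk2.trans (one_pow 2).symm) with hk1 | hk1
  · refine ⟨c, s, U, U + a, V, V + b, n1, by linarith, by linarith, hset _ _ fun x => ?_⟩
    rw [hk1]
    constructor <;> rintro ⟨h1, h2⟩ <;> constructor <;> linarith
  · refine ⟨c, s, U, U + a, V - b, V, n1, by linarith, by linarith, hset _ _ fun x => ?_⟩
    rw [hk1]
    constructor <;> rintro ⟨h1, h2⟩ <;> constructor <;> linarith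

theorem frame_coords {c s : ℝ} (h : c ^ 2 + s ^ 2 = 1) (p : Plane) :
    frame c s (c * p 0 + s * p 1) (-s * p 0 + c * p 1) = p := by
  ext i
  fin_cases i
  · simp; linear_combination p 0 * h
  · simp; linear_combination p 1 * h

/-- A linear form which is not parallel to a side of a box attains its minimum only once. -/
theorem eq_of_min_on_box {α β u₀ u₁ v₀ v₁ m a b a' b' : ℝ} (hα : α ≠ 0) (hβ : β ≠ 0)
    (hm : ∀ x y, u₀ ≤ x → x ≤ u₁ → v₀ ≤ y → y ≤ v₁ → m ≤ α * x + β * y)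
    (ha : u₀ ≤ a ∧ a ≤ u₁) (hb : v₀ ≤ b ∧ b ≤ v₁) (hab : α * a + β * b = m)
    (ha' : u₀ ≤ a' ∧ a' ≤ u₁) (hb' : v₀ ≤ b' ∧ b' ≤ v₁) (hab' : α * a' + β * b' = m) :
    a = a' ∧ b = b' := by
  -- The values at the mixed points `(a, b')` and `(a', b)` add up to `2 * m`, so neither exceeds
  -- `m`.
  have h1 := hm a b' ha.1 ha.2 hb'.1 hb'.2
  have h2 := hm a' b ha'.1 ha'.2 hb.1 hb.2
  have ea : α * a = α * a' := by linarith
  have eb : β * b = β * b' := by linarith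
  exact ⟨mul_left_cancel₀ hα ea, mul_left_cancel₀ hβ eb⟩

/-- A rectangle whose interior misses a
box in the frame `(c, s)`, and which contains a segment of the upper side of this box, is itself a
box in this frame. -/
theorem IsRectangle.eq_obox_of_edge {c s u₀ u₁ v₀ v₁ a b : ℝ} {T : Set Plane}
    (h : c ^ 2 + s ^ 2 = 1) (hv : v₀ < v₁) (hT : IsRectangle T)
    (hd : Disjoint (interior (obox c s u₀ u₁ v₀ v₁)) (interior T))
    (ha : u₀ ≤ a) (hab : a < b) (hb : b ≤ u₁)
    (haT : frame c s a v₁ ∈ T) (hbT : frame c s b v₁ ∈ T) :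
    ∃ u₀' u₁' v₀' v₁', u₀' < u₁' ∧ v₀' < v₁' ∧ T = obox c s u₀' u₁' v₀' v₁' := by
  obtain ⟨c', s', p₀, p₁, q₀, q₁, h', hp, hq, rfl⟩ := hT.exists_obox
  have hconv := convex_obox c' s' p₀ p₁ q₀ q₁
  -- `T` lies above the line of the edge: a segment in `T` from the midpoint `m` of the shared piece
  -- to a point below this line would run through the interior of the box, and `T` is the closure of
  -- its own interior.
  have above : ∀ z ∈ obox c' s' p₀ p₁ q₀ q₁, v₁ ≤ -s * z 0 + c * z 1 := by
    intro z hz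
    by_contra! hlt
    set m := frame c s ((a + b) / 2) v₁ with hm
    have hmT : m ∈ obox c' s' p₀ p₁ q₀ q₁ := by
      have := hconv haT hbT (a := 1 / 2) (b := 1 / 2) (by norm_num) (by norm_num) (by norm_num)
      convert this using 1
      ext i
      fin_cases i <;> simp [hm] <;> ring
    have key : ∀ᶠ t : ℝ in 𝓝[>] 0, m + t • (z - m) ∈ interior (obox c s u₀ u₁ v₀ v₁) := by
      have m1 := frame_fst h ((a + b) / 2) v₁
      have m2 := frame_snd h ((a + b) / 2) v₁
      rw [← hm] at m1 m2
      set X := c * z 0 + s * z 1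
      set Y := -s * z 0 + c * z 1
      have e1 (t : ℝ) : c * (m + t • (z - m)) 0 + s * (m + t • (z - m)) 1 =
          (a + b) / 2 + t * (X - (a + b) / 2) := by
        simp only [PiLp.add_apply, PiLp.smul_apply, PiLp.sub_apply, smul_eq_mul]
        linear_combination (1 - t) * m1
      have e2 (t : ℝ) : -s * (m + t • (z - m)) 0 + c * (m + t • (z - m)) 1 =
          v₁ + t * (Y - v₁) := by
        simp only [PiLp.add_apply, PiLp.smul_apply, PiLp.sub_apply, smul_eq_mul]
        linear_combination (1 - t) * m2
      have c1 : Tendsto (fun t : ℝ => (a + b) / 2 + t * (X - (a + b) / 2)) (𝓝[>] 0)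
          (𝓝 ((a + b) / 2)) := by
        have : Continuous fun t : ℝ => (a + b) / 2 + t * (X - (a + b) / 2) := by fun_prop
        simpa using (this.tendsto 0).mono_left nhdsWithin_le_nhds
      have c2 : Tendsto (fun t : ℝ => v₁ + t * (Y - v₁)) (𝓝[>] 0) (𝓝 v₁) := by
        have : Continuous fun t : ℝ => v₁ + t * (Y - v₁) := by fun_prop
        simpa using (this.tendsto 0).mono_left nhdsWithin_le_nhds
      filter_upwards [c1.eventually (lt_mem_nhds (show u₀ < (a + b) / 2 by linarith)),
        c1.eventually (gt_mem_nhds (show (a + b) / 2 < u₁ by linarith)),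
        c2.eventually (lt_mem_nhds hv), self_mem_nhdsWithin] with t t1 t2 t3 t4
      have t4 : 0 < t := t4
      refine mem_interior_obox ?_ ?_ ?_ ?_
      · rwa [e1]
      · rwa [e1]
      · rwa [e2]
      · rw [e2]
        nlinarith
    obtain ⟨t, ht, ht0, ht1⟩ := (key.and (Ioo_mem_nhdsGT (zero_lt_one' ℝ))).exists
    have hmem : m + t • (z - m) ∈ obox c' s' p₀ p₁ q₀ q₁ :=
      hconv.add_smul_sub_mem hmT hz ⟨ht0.le, ht1.le⟩
    rw [← closure_interior_obox h' hp hq] at hmem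
    obtain ⟨w, hw1, hw2⟩ := mem_closure_iff.1 hmem _ isOpen_interior ht
    exact disjoint_left.1 hd hw1 hw2
  -- The height over the edge is the form `α * u + β * v` in the frame of `T`. It attains its
  -- minimum over `T` at two points, so one coefficient vanishes and the frames differ by quarter
  -- turns.
  set α := c * s' - s * c' with hα
  set β := c * c' + s * s' with hβ
  have hαβ : α ^ 2 + β ^ 2 = 1 := by
    rw [hα, hβ]
    linear_combination (c' ^ 2 + s' ^ 2) * h + h'
  have hzero : α = 0 ∨ β = 0 := by
    by_contra! hne
    have coords (w : Plane) : α * (c' * w 0 + s' * w 1) + β * (-s' * w 0 + c' * w 1) =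
        -s * w 0 + c * w 1 := by
      rw [hα, hβ]
      linear_combination (-s * w 0 + c * w 1) * h'
    have := eq_of_min_on_box hne.1 hne.2 (m := v₁) (fun x y x0 x1 y0 y1 => by
        have := above _ ((frame_mem_obox h').2 ⟨⟨x0, x1⟩, y0, y1⟩)
        rwa [← coords, frame_fst h', frame_snd h'] at this) haT.1 haT.2
      (by rw [coords, frame_snd h]) hbT.1 hbT.2 (by rw [coords, frame_snd h])
    have heq : frame c s a v₁ = frame c s b v₁ := by
      rw [← frame_coords h' (frame c s a v₁), ← frame_coords h' (frame c s b v₁), this.1, this.2]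
    have h1 := frame_fst h a v₁
    rw [heq, frame_fst h] at h1
    linarith
  have hc : c' = c * β - s * α := by rw [hα, hβ]; linear_combination -c' * h
  have hs : s' = s * β + c * α := by rw [hα, hβ]; linear_combination -s' * h
  rcases hzero with h0 | h0
  · rw [h0] at hαβ hc hs
    have : β ^ 2 = 1 ^ 2 := by linarith
    rcases sq_eq_sq_iff_eq_or_eq_neg.1 this with h1 | h1
    · refine ⟨p₀, p₁, q₀, q₁, hp, hq, ?_⟩
      rw [hc, hs, h1]
      congr 1 <;> ring
    · refine ⟨-p₁, -p₀, -q₁, -q₀, by linarith, by linarith, ?_⟩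
      rw [← obox_neg, hc, hs, h1]
      congr 1 <;> ring
  · rw [h0] at hαβ hc hs
    have : α ^ 2 = 1 ^ 2 := by linarith
    rcases sq_eq_sq_iff_eq_or_eq_neg.1 this with h1 | h1
    · refine ⟨-q₁, -q₀, p₀, p₁, by linarith, by linarith, ?_⟩
      rw [← obox_rot, hc, hs, h1]
      congr 1 <;> ring
    · refine ⟨q₀, q₁, -p₁, -p₀, by linarith, by linarith, ?_⟩
      have := obox_rot c s (-p₁) (-p₀) (-q₁) (-q₀)
      rw [neg_neg, neg_neg] at this
      rw [← this, ← obox_neg, hc, hs, h1]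
      congr 1 <;> ring

/-- In a tiling of an axis-parallel square by rectangles, these are axis-parallel: otherwise take,
among the tiles with sides parallel to a given frame, the one whose corner is extreme, and look at
its neighbour along one of the edges at this corner. -/
theorem IsPartition.axis_zero {k : ℕ} {ℓ : ℝ} {P : Set (Set Plane)}
    (hP : IsPartition k (box 0 ℓ 0 ℓ) P) {c s u₀ u₁ v₀ v₁ : ℝ} (h : c ^ 2 + s ^ 2 = 1)
    (hu : u₀ < u₁) (hv : v₀ < v₁) (hmem : obox c s u₀ u₁ v₀ v₁ ∈ P) : c = 0 ∨ s = 0 := by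
  by_contra! hne
  obtain ⟨hc, hs⟩ := hne
  set O := {A | A ∈ P ∧ ∃ u₀ u₁ v₀ v₁, u₀ < u₁ ∧ v₀ < v₁ ∧ A = obox c s u₀ u₁ v₀ v₁} with hO
  have hOne : O.Nonempty := ⟨_, hmem, u₀, u₁, v₀, v₁, hu, hv, rfl⟩
  have hOfin : O.Finite := hP.finite.subset fun A hA => hA.1
  clear hmem hu hv u₀ u₁ v₀ v₁
  have hex : ∀ A, A ∈ O → ∃ u₀ u₁ v₀ v₁, u₀ < u₁ ∧ v₀ < v₁ ∧ A = obox c s u₀ u₁ v₀ v₁ :=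
    fun A hA => hA.2
  choose! u₀ u₁ v₀ v₁ hu hv hbox using hex
  -- The extreme corner is the one with coordinates `u₁ T`, `v₁ T` in the frame.
  obtain ⟨T, hTO, hmax⟩ := exists_max_image O (fun A => u₁ A + v₁ A) hOfin hOne
  have hTP : T ∈ P := hTO.1
  have hTS : T ⊆ box 0 ℓ 0 ℓ := hP.sUnion_eq ▸ subset_sUnion_of_mem hTP
  have huT := hu T hTO
  have hvT := hv T hTO
  have hTb := hbox T hTO
  have hTm (u v : ℝ) : frame c s u v ∈ T ↔ (u₀ T ≤ u ∧ u ≤ u₁ T) ∧ v₀ T ≤ v ∧ v ≤ v₁ T := by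
    conv_lhs => rw [hTb]
    exact frame_mem_obox h
  have corner (u : ℝ) (h1 : u₀ T ≤ u) (h2 : u ≤ u₁ T) : frame c s u (v₁ T) ∈ box 0 ℓ 0 ℓ := by
    apply hTS
    exact (hTm _ _).2 ⟨⟨h1, h2⟩, hvT.le, le_rfl⟩
  have hcover : ∀ ε, 0 < ε → ε < u₁ T - u₀ T →
      ∃ A ∈ P \ {T}, frame c s (u₁ T - ε) (v₁ T) ∈ A := by
    intro ε h0 h1
    set q := frame c s (u₁ T - ε) (v₁ T) with hq
    by_contra! hno
    have hclosed : IsClosed (⋃ A ∈ P \ {T}, A) :=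
      (hP.finite.subset sdiff_subset).isClosed_biUnion fun A hA => by
        obtain ⟨c', s', p₀, p₁, q₀, q₁, -, -, -, rfl⟩ := (hP.isRectangle A hA.1).exists_obox
        exact isClosed_obox _ _ _ _ _ _
    have hqU : q ∈ (⋃ A ∈ P \ {T}, A)ᶜ := by simpa using hno
    -- As `c` and `s` are nonzero, both coordinates are strictly monotone along the edge. So a point
    -- between its ends is interior to the square, and the points just beyond the edge are covered
    -- by other tiles.
    have hqS : q ∈ interior (box 0 ℓ 0 ℓ) := by
      obtain ⟨⟨a1, a2⟩, a3, a4⟩ := corner (u₀ T) le_rfl huT.le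
      obtain ⟨⟨b1, b2⟩, b3, b4⟩ := corner (u₁ T) huT.le le_rfl
      simp only [frame_zero, frame_one] at a1 a2 a3 a4 b1 b2 b3 b4
      rw [interior_box]
      simp only [mem_ofPred_eq, hq, frame_zero, frame_one]
      have l1 : u₀ T < u₁ T - ε := by linarith
      have l2 : u₁ T - ε < u₁ T := by linarith
      constructor
      · rcases lt_or_gt_of_ne hc with hc | hc
        · have m1 := mul_lt_mul_of_neg_left l1 hc
          have m2 := mul_lt_mul_of_neg_left l2 hc
          constructor <;> linarith
        · have m1 := mul_lt_mul_of_pos_left l1 hc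
          have m2 := mul_lt_mul_of_pos_left l2 hc
          constructor <;> linarith
      · rcases lt_or_gt_of_ne hs with hs | hs
        · have m1 := mul_lt_mul_of_neg_left l1 hs
          have m2 := mul_lt_mul_of_neg_left l2 hs
          constructor <;> linarith
        · have m1 := mul_lt_mul_of_pos_left l1 hs
          have m2 := mul_lt_mul_of_pos_left l2 hs
          constructor <;> linarith
    have hcont : Continuous fun δ : ℝ => frame c s (u₁ T - ε) (v₁ T + δ) := by
      unfold frame
      fun_prop
    have ht : Tendsto (fun δ : ℝ => frame c s (u₁ T - ε) (v₁ T + δ)) (𝓝[>] 0) (𝓝 q) := by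
      simpa using (hcont.tendsto 0).mono_left nhdsWithin_le_nhds
    obtain ⟨δ, ⟨d1, d2⟩, d3⟩ := ((ht.eventually (hclosed.isOpen_compl.mem_nhds hqU)).and
      (ht.eventually (isOpen_interior.mem_nhds hqS)) |>.and self_mem_nhdsWithin).exists
    have d3 : 0 < δ := d3
    have d2 := interior_subset d2
    rw [← hP.sUnion_eq] at d2
    obtain ⟨A, hA, hA2⟩ := d2
    by_cases hAT : A = T
    · rw [hAT, hTm] at hA2
      linarith [hA2.2.2]
    · exact d1 (mem_biUnion ⟨hA, hAT⟩ hA2)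
  have hev : ∀ᶠ ε in 𝓝[>] (0 : ℝ), ∃ A ∈ P \ {T}, frame c s (u₁ T - ε) (v₁ T) ∈ A := by
    filter_upwards [Ioo_mem_nhdsGT (sub_pos.2 huT)] with ε hε
    exact hcover ε hε.1 hε.2
  -- There are finitely many tiles, so a single `A` contains points of the edge arbitrarily close to
  -- the corner. Being closed and convex, it contains the corner and a piece of the edge.
  obtain ⟨A, ⟨hAP, hAT⟩, hfreq⟩ := (frequently_exists_finite
    (hP.finite.subset sdiff_subset)).1 hev.frequently
  have hAT : A ≠ T := hAT
  have hcl : frame c s (u₁ T) (v₁ T) ∈ A := by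
    obtain ⟨c', s', p₀, p₁, q₀, q₁, -, -, -, rfl⟩ := (hP.isRectangle A hAP).exists_obox
    refine (isClosed_obox _ _ _ _ _ _).mem_of_frequently_of_tendsto hfreq ?_
    have hcont : Continuous fun ε : ℝ => frame c s (u₁ T - ε) (v₁ T) := by
      unfold frame
      fun_prop
    simpa using (hcont.tendsto 0).mono_left nhdsWithin_le_nhds
  obtain ⟨ε, hεA, hε⟩ := (hfreq.and_eventually (Ioo_mem_nhdsGT (sub_pos.2 huT))).exists
  have hd := hP.disjoint hTP hAP hAT.symm
  have hAO : A ∈ O := by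
    refine ⟨hAP, (hP.isRectangle A hAP).eq_obox_of_edge h hvT (by rw [hTb] at hd; exact hd)
      (a := u₁ T - ε) (b := u₁ T) ?_ ?_ le_rfl hεA hcl⟩
    · linarith [hε.2]
    · linarith [hε.1]
  have hAm := hmax A hAO
  have hAb := hbox A hAO
  have huA := hu A hAO
  have hvA := hv A hAO
  rw [hAb, frame_mem_obox h] at hcl
  obtain ⟨⟨c1, c2⟩, c3, c4⟩ := hcl
  -- The corner of `T` lies in `A`, and by maximality the sum `u₁ A + v₁ A` is no larger. So both
  -- tiles have the same upper corner and overlap near it.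
  obtain ⟨x, hx1, hx2⟩ := exists_between (show max (u₀ A) (u₀ T) < u₁ T from max_lt (by linarith) huT)
  obtain ⟨y, hy1, hy2⟩ := exists_between (show max (v₀ A) (v₀ T) < v₁ T from max_lt (by linarith) hvT)
  rw [max_lt_iff] at hx1 hy1
  refine disjoint_left.1 hd (?_ : frame c s x y ∈ interior T) ?_
  · rw [hTb]
    apply frame_mem_interior_obox h <;> linarith
  · rw [hAb]
    apply frame_mem_interior_obox h <;> linarith

theorem IsPartition.exists_box {k : ℕ} {ℓ : ℝ} {P : Set (Set Plane)}
    (hP : IsPartition k (box 0 ℓ 0 ℓ) P) {A : Set Plane} (hA : A ∈ P) :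
    ∃ x₀ x₁ y₀ y₁, x₀ < x₁ ∧ y₀ < y₁ ∧ A = box x₀ x₁ y₀ y₁ := by
  obtain ⟨c, s, u₀, u₁, v₀, v₁, h, hu, hv, rfl⟩ := (hP.isRectangle A hA).exists_obox
  rcases hP.axis_zero h hu hv hA with rfl | rfl
  · rcases sq_eq_sq_iff_eq_or_eq_neg.1 (show s ^ 2 = 1 ^ 2 by linarith) with rfl | rfl
    · refine ⟨-v₁, -v₀, u₀, u₁, by linarith, hu, ?_⟩
      rw [← obox_one_zero, ← obox_rot, neg_zero]
    · refine ⟨v₀, v₁, -u₁, -u₀, hv, by linarith, ?_⟩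
      have h1 := obox_rot 1 0 (-u₁) (-u₀) (-v₁) (-v₀)
      have h2 := obox_neg 0 1 u₀ u₁ v₀ v₁
      rw [neg_zero] at h1 h2
      rw [h2, h1, neg_neg, neg_neg, obox_one_zero]
  · rcases sq_eq_sq_iff_eq_or_eq_neg.1 (show c ^ 2 = 1 ^ 2 by linarith) with rfl | rfl
    · exact ⟨u₀, u₁, v₀, v₁, hu, hv, obox_one_zero _ _ _ _⟩
    · refine ⟨-u₁, -u₀, -v₁, -v₀, by linarith, by linarith, ?_⟩
      rw [← obox_one_zero, ← obox_neg, neg_zero]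

/-! ### From partitions to coordinates -/

theorem congruent_box {x₀ x₁ y₀ y₁ x₀' x₁' y₀' y₁' : ℝ} (hx : x₀ < x₁) (hy : y₀ < y₁)
    (hx' : x₀' < x₁') (hy' : y₀' < y₁') (h1 : x₁ - x₀ = x₁' - x₀') (h2 : y₁ - y₀ = y₁' - y₀') :
    Congruent (box x₀ x₁ y₀ y₁) (box x₀' x₁' y₀' y₁') := by
  refine ⟨_, _, hasSides_box hx hy, ?_⟩
  rw [h1, h2]
  exact hasSides_box hx' hy'

theorem isClosed_sUnion_of_boxes {P : Set (Set Plane)} (hP : P.Finite)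
    (h : ∀ A ∈ P, ∃ x₀ x₁ y₀ y₁, A = box x₀ x₁ y₀ y₁) : IsClosed (⋃₀ P) := by
  rw [sUnion_eq_biUnion]
  refine hP.isClosed_biUnion fun A hA => ?_
  obtain ⟨x₀, x₁, y₀, y₁, rfl⟩ := h A hA
  exact isClosed_box _ _ _ _

/-- The germ of the square at a point, in a given direction, is covered by one of the tiles. -/
theorem IsPartition.exists_germ {k : ℕ} {S : Set Plane} {P : Set (Set Plane)}
    (hP : IsPartition k S P) (hbox : ∀ A ∈ P, ∃ x₀ x₁ y₀ y₁, A = box x₀ x₁ y₀ y₁)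
    (x y σ ρ : ℝ) (h : ∀ᶠ δ : ℝ in 𝓝[>] 0, (!₂[x + σ * δ, y + ρ * δ] : Plane) ∈ S) :
    ∃ A ∈ P, (!₂[x, y] : Plane) ∈ A ∧ ∃ δ > 0, (!₂[x + σ * δ, y + ρ * δ] : Plane) ∈ A := by
  have h1 : ∀ᶠ δ : ℝ in 𝓝[>] 0, ∃ A ∈ P, (!₂[x + σ * δ, y + ρ * δ] : Plane) ∈ A := by
    filter_upwards [h] with δ hδ
    rwa [← hP.sUnion_eq] at hδ
  obtain ⟨A, hA, hf⟩ := (frequently_exists_finite hP.finite).1 h1.frequently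
  refine ⟨A, hA, ?_, ?_⟩
  · obtain ⟨x₀, x₁, y₀, y₁, rfl⟩ := hbox A hA
    refine (isClosed_box _ _ _ _).mem_of_frequently_of_tendsto hf ?_
    have hcont : Continuous fun δ : ℝ => (!₂[x + σ * δ, y + ρ * δ] : Plane) := by fun_prop
    simpa using (hcont.tendsto 0).mono_left nhdsWithin_le_nhds
  · obtain ⟨δ, h1, h2⟩ := (hf.and_eventually self_mem_nhdsWithin).exists
    exact ⟨δ, h2, h1⟩

theorem eventually_add_mul_mem_Icc {ℓ x σ : ℝ} (h0 : 0 ≤ x) (h1 : x ≤ ℓ) (hσ : 0 < x ∨ 0 ≤ σ)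
    (hσ' : x < ℓ ∨ σ ≤ 0) : ∀ᶠ δ : ℝ in 𝓝[>] 0, 0 ≤ x + σ * δ ∧ x + σ * δ ≤ ℓ := by
  have hcont : Continuous fun δ : ℝ => x + σ * δ := by fun_prop
  have ht : Tendsto (fun δ : ℝ => x + σ * δ) (𝓝[>] 0) (𝓝 x) := by
    simpa using (hcont.tendsto 0).mono_left nhdsWithin_le_nhds
  refine Filter.Eventually.and ?_ ?_
  · rcases hσ with h | h
    · filter_upwards [ht.eventually (lt_mem_nhds h)] with δ hδ using hδ.le
    · filter_upwards [self_mem_nhdsWithin] with δ hδ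
      exact add_nonneg h0 (mul_nonneg h (le_of_lt hδ))
  · rcases hσ' with h | h
    · filter_upwards [ht.eventually (gt_mem_nhds h)] with δ hδ using hδ.le
    · filter_upwards [self_mem_nhdsWithin] with δ hδ
      linarith [mul_nonpos_of_nonpos_of_nonneg h (le_of_lt hδ)]

/-- A proper perfect Mondrian partition in coordinates. -/
theorem IsProperPerfectMondrian.exists_equiTiling {ℓ : ℝ} (hℓ : 0 < ℓ) {P : Set (Set Plane)}
    (h : IsProperPerfectMondrian 7 (box 0 ℓ 0 ℓ) P) :
    ∃ τ : EquiTiling P ℓ, range τ.tile = P := by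
  have hP := h.isPartition
  have hex : ∀ A : P, ∃ x₀ x₁ y₀ y₁, x₀ < x₁ ∧ y₀ < y₁ ∧ A.1 = box x₀ x₁ y₀ y₁ :=
    fun A => hP.exists_box A.2
  choose x₀ x₁ y₀ y₁ hx hy hbox using hex
  have hbox' : ∀ A ∈ P, ∃ x₀ x₁ y₀ y₁, A = box x₀ x₁ y₀ y₁ := fun A hA => ⟨_, _, _, _, hbox ⟨A, hA⟩⟩
  have hsub (A : P) : box (x₀ A) (x₁ A) (y₀ A) (y₁ A) ⊆ box 0 ℓ 0 ℓ := by
    rw [← hbox A, ← hP.sUnion_eq]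
    exact subset_sUnion_of_mem A.2
  have hlow (A : P) : (0 ≤ x₀ A ∧ x₀ A ≤ ℓ) ∧ 0 ≤ y₀ A ∧ y₀ A ≤ ℓ := by
    have : (!₂[x₀ A, y₀ A] : Plane) ∈ box (x₀ A) (x₁ A) (y₀ A) (y₁ A) := by
      simp [mem_box, (hx A).le, (hy A).le]
    simpa [mem_box] using hsub A this
  have hupp (A : P) : (0 ≤ x₁ A ∧ x₁ A ≤ ℓ) ∧ 0 ≤ y₁ A ∧ y₁ A ≤ ℓ := by
    have : (!₂[x₁ A, y₁ A] : Plane) ∈ box (x₀ A) (x₁ A) (y₀ A) (y₁ A) := by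
      simp [mem_box, (hx A).le, (hy A).le]
    simpa [mem_box] using hsub A this
  have harea (A : P) : (x₁ A - x₀ A) * (y₁ A - y₀ A) = ℓ ^ 2 / 7 := by
    have := h.isPerfect A.1 A.2
    rw [hbox A, volume_box, volume_box, sub_zero, ← ENNReal.ofReal_mul (sub_nonneg.2 (hx A).le),
      ← ENNReal.ofReal_mul hℓ.le, show ((7 : ℕ) : ENNReal) = ENNReal.ofReal 7 by simp,
      ← ENNReal.ofReal_div_of_pos (by norm_num)] at this
    rw [ENNReal.ofReal_eq_ofReal_iff (mul_nonneg (sub_nonneg.2 (hx A).le) (sub_nonneg.2 (hy A).le))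
      (by positivity)] at this
    rw [this]
    ring
  -- The signs `σ`, `ρ` select the quadrant. A tile that contains the point and a further point of
  -- the diagonal ray gives the strict inequalities of `ne`, `nw`, `se`, `sw`.
  have germ (x y σ ρ : ℝ) (ha : ∀ᶠ δ : ℝ in 𝓝[>] 0, 0 ≤ x + σ * δ ∧ x + σ * δ ≤ ℓ)
      (hb : ∀ᶠ δ : ℝ in 𝓝[>] 0, 0 ≤ y + ρ * δ ∧ y + ρ * δ ≤ ℓ) :
      ∃ A : P, ((x₀ A ≤ x ∧ x ≤ x₁ A) ∧ y₀ A ≤ y ∧ y ≤ y₁ A) ∧ ∃ δ > 0,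
        (x₀ A ≤ x + σ * δ ∧ x + σ * δ ≤ x₁ A) ∧ y₀ A ≤ y + ρ * δ ∧ y + ρ * δ ≤ y₁ A := by
    obtain ⟨A, hA, h1, δ, hδ, h2⟩ := hP.exists_germ hbox' x y σ ρ (by
      filter_upwards [ha, hb] with δ h1 h2
      simpa [mem_box] using And.intro h1 h2)
    rw [show A = _ from hbox ⟨A, hA⟩] at h1 h2
    refine ⟨⟨A, hA⟩, by simpa [mem_box] using h1, δ, hδ, h2⟩
  refine ⟨⟨x₀, x₁, y₀, y₁, hℓ, ?_, hx, hy, fun A => (hlow A).1.1, fun A => (hupp A).1.2,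
    fun A => (hlow A).2.1, fun A => (hupp A).2.2, ?_, ?_, ?_, ?_, ?_, harea, ?_, ?_⟩, ?_⟩
  · exact hP.ncard_eq
  · intro x y h1 h2 h3 h4
    obtain ⟨A, ⟨⟨a1, a2⟩, a3, a4⟩, δ, hδ, ⟨b1, b2⟩, b3, b4⟩ := germ x y 1 1
      (eventually_add_mul_mem_Icc h1 h2.le (Or.inr (by norm_num)) (Or.inl h2))
      (eventually_add_mul_mem_Icc h3 h4.le (Or.inr (by norm_num)) (Or.inl h4))
    exact ⟨A, by linarith, by linarith, by linarith, by linarith⟩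
  · intro x y h1 h2 h3 h4
    obtain ⟨A, ⟨⟨a1, a2⟩, a3, a4⟩, δ, hδ, ⟨b1, b2⟩, b3, b4⟩ := germ x y (-1) 1
      (eventually_add_mul_mem_Icc h1.le h2 (Or.inl h1) (Or.inr (by norm_num)))
      (eventually_add_mul_mem_Icc h3 h4.le (Or.inr (by norm_num)) (Or.inl h4))
    exact ⟨A, by linarith, by linarith, by linarith, by linarith⟩
  · intro x y h1 h2 h3 h4
    obtain ⟨A, ⟨⟨a1, a2⟩, a3, a4⟩, δ, hδ, ⟨b1, b2⟩, b3, b4⟩ := germ x y 1 (-1)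
      (eventually_add_mul_mem_Icc h1 h2.le (Or.inr (by norm_num)) (Or.inl h2))
      (eventually_add_mul_mem_Icc h3.le h4 (Or.inl h3) (Or.inr (by norm_num)))
    exact ⟨A, by linarith, by linarith, by linarith, by linarith⟩
  · intro x y h1 h2 h3 h4
    obtain ⟨A, ⟨⟨a1, a2⟩, a3, a4⟩, δ, hδ, ⟨b1, b2⟩, b3, b4⟩ := germ x y (-1) (-1)
      (eventually_add_mul_mem_Icc h1.le h2 (Or.inl h1) (Or.inr (by norm_num)))
      (eventually_add_mul_mem_Icc h3.le h4 (Or.inl h3) (Or.inr (by norm_num)))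
    exact ⟨A, by linarith, by linarith, by linarith, by linarith⟩
  · intro A B hAB
    by_contra! hn
    obtain ⟨n1, n2, n3, n4⟩ := hn
    have hd := hP.disjoint A.2 B.2 (fun h => hAB (Subtype.ext h))
    simp only [hbox, interior_box] at hd
    obtain ⟨x, hx1, hx2⟩ := exists_between (show max (x₀ A) (x₀ B) < min (x₁ A) (x₁ B) from
      max_lt (lt_min (hx A) n2) (lt_min n1 (hx B)))
    obtain ⟨y, hy1, hy2⟩ := exists_between (show max (y₀ A) (y₀ B) < min (y₁ A) (y₁ B) from
      max_lt (lt_min (hy A) n4) (lt_min n3 (hy B)))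
    rw [max_lt_iff] at hx1 hy1
    rw [lt_min_iff] at hx2 hy2
    have hmem : (!₂[x, y] : Plane) ∈ {p : Plane | (x₀ A < p 0 ∧ p 0 < x₁ A) ∧
        y₀ A < p 1 ∧ p 1 < y₁ A} := ⟨⟨hx1.1, hx2.1⟩, hy1.1, hy2.1⟩
    exact disjoint_left.1 hd hmem ⟨⟨hx1.2, hx2.2⟩, hy1.2, hy2.2⟩
  · intro A B hw
    by_contra hAB
    have hh : y₁ A - y₀ A = y₁ B - y₀ B := by
      have h1 := harea A
      rw [hw, ← harea B] at h1
      exact mul_left_cancel₀ (sub_pos.2 (hx B)).ne' h1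
    refine h.isMondrian A.2 B.2 (fun h => hAB (Subtype.ext h)) ?_
    rw [hbox A, hbox B]
    exact congruent_box (hx A) (hy A) (hx B) (hy B) hw hh
  · intro u₀ u₁ v₀ v₁ hu hv l1 l2 l3 l4 H A B hAB hA hB C
    set Q : Set (Set Plane) := Subtype.val '' {D : P | u₀ ≤ x₀ D ∧ x₁ D ≤ u₁ ∧ v₀ ≤ y₀ D ∧
      y₁ D ≤ v₁} with hQ
    have hQP : Q ⊆ P := by rintro _ ⟨D, -, rfl⟩; exact D.2
    have hQfin : Q.Finite := hP.finite.subset hQP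
    have hunion : ⋃₀ Q = box u₀ u₁ v₀ v₁ := by
      apply Subset.antisymm
      · rintro p ⟨_, ⟨D, ⟨d1, d2, d3, d4⟩, rfl⟩, hp⟩
        rw [hbox D] at hp
        obtain ⟨⟨p1, p2⟩, p3, p4⟩ := hp
        exact ⟨⟨by linarith, by linarith⟩, by linarith, by linarith⟩
      -- A tile that contains an interior point of the box must lie inside the box by `H`; the
      -- boundary follows by closure.
      · rw [← closure_interior_box hu hv]
        refine closure_minimal ?_ (isClosed_sUnion_of_boxes hQfin fun A hA => hbox' A (hQP hA))
        rw [interior_box]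
        rintro p ⟨⟨p1, p2⟩, p3, p4⟩
        have hpS : p ∈ ⋃₀ P := by
          rw [hP.sUnion_eq]
          exact ⟨⟨by linarith, by linarith⟩, by linarith, by linarith⟩
        obtain ⟨D, hD, hpD⟩ := hpS
        refine ⟨D, ⟨⟨D, hD⟩, ?_, rfl⟩, hpD⟩
        rw [show D = _ from hbox ⟨D, hD⟩] at hpD
        obtain ⟨⟨q1, q2⟩, q3, q4⟩ := hpD
        rcases H ⟨D, hD⟩ with h' | h' | h' | h' | h'
        · exact h'
        all_goals linarith
    have hrect : IsRectangle (⋃₀ Q) := by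
      rw [hunion]
      exact ⟨_, _, hasSides_box hu hv⟩
    have h1 : 1 < Q.ncard := (one_lt_ncard_iff hQfin).2
      ⟨A, B, ⟨A, hA, rfl⟩, ⟨B, hB, rfl⟩, fun h => hAB (Subtype.ext h)⟩
    have h7 : ¬ Q.ncard < 7 := fun h2 => h.isProper Q hQP h1 h2 hrect
    have hQeq : Q = P := eq_of_subset_of_ncard_le hQP (by rw [hP.ncard_eq]; omega) hP.finite
    have hC : C.1 ∈ Q := by rw [hQeq]; exact C.2
    obtain ⟨D, hD, hDC⟩ := hC
    rwa [← Subtype.ext hDC]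
  · ext A
    constructor
    · rintro ⟨B, rfl⟩
      have := B.2
      rw [hbox B] at this
      exact this
    · intro hA
      exact ⟨⟨A, hA⟩, (hbox ⟨A, hA⟩).symm⟩

theorem IsProperPerfectMondrian.isSpiral {S : Set Plane} (hS : IsSquareSet S)
    {P : Set (Set Plane)} (h : IsProperPerfectMondrian 7 S P) : IsSpiral S P := by
  obtain ⟨ℓ, hℓ, -, f, rfl⟩ := hS
  have h' := h.image f.symm
  rw [← image_comp, f.symm_comp_self, image_id] at h'
  obtain ⟨τ, hτ⟩ := h'.exists_equiTiling hℓ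
  have hs := τ.isSpiral.image f
  have e := mapPartition_symm f.symm P
  rw [f.symm_symm] at e
  rwa [hτ, e] at hs

/-! ### Metric invariants and convexity of rectangles -/

theorem IsRectangle.convex {A : Set Plane} (h : IsRectangle A) : Convex ℝ A := by
  obtain ⟨c, s, u₀, u₁, v₀, v₁, -, -, -, rfl⟩ := h.exists_obox
  exact convex_obox _ _ _ _ _ _

theorem IsRectangle.closure_interior {A : Set Plane} (h : IsRectangle A) :
    closure (interior A) = A := by
  obtain ⟨c, s, u₀, u₁, v₀, v₁, hcs, hu, hv, rfl⟩ := h.exists_obox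
  exact closure_interior_obox hcs hu hv

/-- The square of the diameter of a rectangle. -/
theorem HasSides.diam_sq {A : Set Plane} {a b : ℝ} (h : HasSides A a b) :
    Metric.diam A ^ 2 = a ^ 2 + b ^ 2 := by
  obtain ⟨ha, hb, f, rfl⟩ := h
  rw [f.diam_image]
  have hle : ∀ p ∈ box 0 a 0 b, ∀ q ∈ box 0 a 0 b, dist p q ≤ √(a ^ 2 + b ^ 2) := by
    rintro p ⟨⟨p1, p2⟩, p3, p4⟩ q ⟨⟨q1, q2⟩, q3, q4⟩
    rw [EuclideanSpace.dist_eq]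
    apply Real.sqrt_le_sqrt
    simp only [Fin.sum_univ_two, Real.dist_eq, sq_abs]
    apply add_le_add
    · apply sq_le_sq' <;> linarith
    · apply sq_le_sq' <;> linarith
  have h1 : Metric.diam (box 0 a 0 b) = √(a ^ 2 + b ^ 2) := by
    apply le_antisymm
    · exact Metric.diam_le_of_forall_dist_le (Real.sqrt_nonneg _) hle
    · have hd := Metric.dist_le_diam_of_mem (Metric.isBounded_iff.2 ⟨_, fun p hp q hq => hle p hp q hq⟩)
        (show (!₂[a, b] : Plane) ∈ box 0 a 0 b by simp [mem_box, ha.le, hb.le])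
        (show (!₂[0, 0] : Plane) ∈ box 0 a 0 b by simp [mem_box, ha.le, hb.le])
      simpa [EuclideanSpace.dist_eq, Fin.sum_univ_two] using hd
  rw [h1, Real.sq_sqrt (by positivity)]

/-- The diameter is symmetric in the two sides, so comparing diameters refutes congruence also for
tiles turned by a right angle. -/
theorem Congruent.diam_eq {A B : Set Plane} (h : Congruent A B) :
    Metric.diam A ^ 2 = Metric.diam B ^ 2 := by
  obtain ⟨a, b, h1, h2⟩ := h
  rw [h1.diam_sq, h2.diam_sq]

theorem diam_box_bounds {x₀ x₁ y₀ y₁ ℓ a b c d : ℝ} (hℓ : 0 < ℓ) (ha : 0 < a) (hc : 0 < c)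
    (h1 : a * ℓ ≤ x₁ - x₀) (h2 : x₁ - x₀ ≤ b * ℓ) (h3 : c * ℓ ≤ y₁ - y₀) (h4 : y₁ - y₀ ≤ d * ℓ) :
    (a ^ 2 + c ^ 2) * ℓ ^ 2 ≤ Metric.diam (box x₀ x₁ y₀ y₁) ^ 2 ∧
      Metric.diam (box x₀ x₁ y₀ y₁) ^ 2 ≤ (b ^ 2 + d ^ 2) * ℓ ^ 2 := by
  have aℓ := mul_pos ha hℓ
  have cℓ := mul_pos hc hℓ
  rw [(hasSides_box (by linarith) (by linarith)).diam_sq]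
  have k1 := pow_le_pow_left₀ aℓ.le h1 2
  have k2 := pow_le_pow_left₀ (aℓ.le.trans h1) h2 2
  have k3 := pow_le_pow_left₀ cℓ.le h3 2
  have k4 := pow_le_pow_left₀ (cℓ.le.trans h3) h4 2
  constructor <;> linarith

/-- If the union of some tiles of a partition is a rectangle and contains two points, then the tile
around the midpoint of these points is among them. -/
theorem IsPartition.mem_of_midpoint {k : ℕ} {S : Set Plane} {P Q : Set (Set Plane)}
    (hP : IsPartition k S P) (hQ : Q ⊆ P) (hR : IsRectangle (⋃₀ Q)) {X Y Z : Set Plane}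
    (hX : X ∈ Q) (hY : Y ∈ Q) (hZ : Z ∈ P) {p q : Plane} (hp : p ∈ X) (hq : q ∈ Y)
    (hm : midpoint ℝ p q ∈ interior Z) : Z ∈ Q := by
  have hmem : midpoint ℝ p q ∈ ⋃₀ Q :=
    hR.convex.midpoint_mem (mem_sUnion_of_mem hp hX) (mem_sUnion_of_mem hq hY)
  obtain ⟨W, hW, hmW⟩ := hmem
  by_contra hZQ
  have hd := hP.disjoint hZ (hQ hW) (fun h => hZQ (h ▸ hW))
  rw [← (hP.isRectangle W (hQ hW)).closure_interior] at hmW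
  obtain ⟨w, hw1, hw2⟩ := mem_closure_iff.1 hmW _ isOpen_interior hm
  exact disjoint_left.1 hd hw1 hw2

/-! ### Uniqueness of the perfect spiral -/

/-- The equations for the coordinates of a perfect partition with spiral pattern. -/
structure SpiralCoords (ℓ x₁ x₂ x₃ y₁ y₂ y₃ : ℝ) : Prop where
  x₁_pos : 0 < x₁
  x₁_lt : x₁ < x₂
  x₂_lt : x₂ < x₃
  x₃_lt : x₃ < ℓ
  y₁_pos : 0 < y₁
  y₁_lt : y₁ < y₂
  y₂_lt : y₂ < y₃
  y₃_lt : y₃ < ℓ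
  areaA : x₃ * (ℓ - y₃) = ℓ ^ 2 / 7
  areaB : (ℓ - x₃) * (ℓ - y₁) = ℓ ^ 2 / 7
  areaC : (ℓ - x₁) * y₁ = ℓ ^ 2 / 7
  areaD : x₁ * y₂ = ℓ ^ 2 / 7
  areaE : x₂ * (y₃ - y₂) = ℓ ^ 2 / 7
  areaF : (x₂ - x₁) * (y₂ - y₁) = ℓ ^ 2 / 7
  areaG : (x₃ - x₂) * (y₃ - y₁) = ℓ ^ 2 / 7

namespace SpiralCoords

variable {ℓ x₁ x₂ x₃ y₁ y₂ y₃ x₁' x₂' x₃' y₁' y₂' y₃' : ℝ}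

/-- A chase around the spiral. A larger `x₁` lowers `y₂` and raises `y₁`; this lowers `x₃`, then
`y₃`, and `x₂` through the tile between `x₂` and `x₃`. The innermost tile becomes narrower and,
since `y₁` and `y₂` approach each other, also shorter, so its area cannot stay the same. -/
theorem not_x₁_lt (h : SpiralCoords ℓ x₁ x₂ x₃ y₁ y₂ y₃)
    (h' : SpiralCoords ℓ x₁' x₂' x₃' y₁' y₂' y₃') : ¬ x₁ < x₁' := by
  obtain ⟨a1, a2, a3, a4, a5, a6, a7, a8, A, B, C, D, E, F, G⟩ := h
  obtain ⟨a1', a2', a3', a4', a5', a6', a7', a8', A', B', C', D', E', F', G'⟩ := h'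
  intro hlt
  have h1 : y₂' < y₂ := snd_lt_of_mul_eq (D.trans D'.symm) hlt a1 (by linarith)
  have h2 : y₁ < y₁' := snd_lt_of_mul_eq (C'.trans C.symm) (by linarith) (by linarith) a5
  have h3 : ℓ - x₃ < ℓ - x₃' := snd_lt_of_mul_eq (p := ℓ - y₁') (p' := ℓ - y₁) (by linarith)
    (by linarith) (by linarith) (by linarith)
  have h4 : ℓ - y₃ < ℓ - y₃' := snd_lt_of_mul_eq (A'.trans A.symm) (by linarith) (by linarith)
    (by linarith)
  have h5 : x₃ - x₂ < x₃' - x₂' := snd_lt_of_mul_eq (p := y₃' - y₁') (p' := y₃ - y₁) (by linarith)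
    (by linarith) (by linarith) (by linarith)
  have h6 : y₂ - y₁ < y₂' - y₁' := snd_lt_of_mul_eq (F'.trans F.symm) (by linarith) (by linarith)
    (by linarith)
  linarith

/-- There is at most one perfect partition with spiral pattern. -/
theorem unique (h : SpiralCoords ℓ x₁ x₂ x₃ y₁ y₂ y₃)
    (h' : SpiralCoords ℓ x₁' x₂' x₃' y₁' y₂' y₃') :
    x₁ = x₁' ∧ x₂ = x₂' ∧ x₃ = x₃' ∧ y₁ = y₁' ∧ y₂ = y₂' ∧ y₃ = y₃' := by
  have e1 : x₁ = x₁' := le_antisymm (not_lt.1 (h'.not_x₁_lt h)) (not_lt.1 (h.not_x₁_lt h'))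
  obtain ⟨a1, a2, a3, a4, a5, a6, a7, a8, A, B, C, D, E, F, G⟩ := h
  obtain ⟨a1', a2', a3', a4', a5', a6', a7', a8', A', B', C', D', E', F', G'⟩ := h'
  subst e1
  have e2 : y₁ = y₁' := mul_left_cancel₀ (ne_of_gt (by linarith)) (C.trans C'.symm)
  have e3 : y₂ = y₂' := mul_left_cancel₀ (ne_of_gt (by linarith)) (D.trans D'.symm)
  subst e2 e3
  have e4 : ℓ - x₃ = ℓ - x₃' := mul_right_cancel₀ (ne_of_gt (by linarith)) (B.trans B'.symm)
  have e4 : x₃ = x₃' := by linarith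
  subst e4
  have e5 : ℓ - y₃ = ℓ - y₃' := mul_left_cancel₀ (ne_of_gt (by linarith)) (A.trans A'.symm)
  have e5 : y₃ = y₃' := by linarith
  subst e5
  have e6 : x₂ - x₁ = x₂' - x₁ := mul_right_cancel₀ (ne_of_gt (by linarith)) (F.trans F'.symm)
  exact ⟨rfl, by linarith, rfl, rfl, rfl, rfl⟩

end SpiralCoords

/-! ### The spiral as a proper perfect Mondrian partition -/

/-- The implications between tiles that follow from convexity of the union generate everything from
any two tiles. -/
theorem all_of_two {a b c d e f g : Prop}
    (rab : a → b → f) (rac : a → c → d) (rad : a → d → f) (rae : a → e → g) (raf : a → f → d)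
    (rag : a → g → f) (rbc : b → c → g) (rbd : b → d → e) (rbe : b → e → f) (rbf : b → f → e)
    (rbg : b → g → a) (rcd : c → d → g) (rce : c → e → f) (rcf : c → f → g) (rcg : c → g → b)
    (rde : d → e → f) (rdf : d → f → c) (rdg : d → g → f) (ref : e → f → d) (reg : e → g → f)
    (rfg : f → g → e)
    (two : (a ∧ (b ∨ c ∨ d ∨ e ∨ f ∨ g)) ∨ (b ∧ (c ∨ d ∨ e ∨ f ∨ g)) ∨ (c ∧ (d ∨ e ∨ f ∨ g)) ∨
      (d ∧ (e ∨ f ∨ g)) ∨ (e ∧ (f ∨ g)) ∨ (f ∧ g)) : a ∧ b ∧ c ∧ d ∧ e ∧ f ∧ g := by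
  rcases two with ⟨h, h0 | h0 | h0 | h0 | h0 | h0⟩ | ⟨h, h0 | h0 | h0 | h0 | h0⟩ | ⟨h, h0 | h0 | h0 | h0⟩ |
    ⟨h, h0 | h0 | h0⟩ | ⟨h, h0 | h0⟩ | ⟨h, h0⟩ <;> simp_all only [forall_const, and_self]

theorem two_of_mem {α : Type*} {Q : Set α} {A B C D E F G X Y : α} (hX : X ∈ Q) (hY : Y ∈ Q)
    (hXY : X ≠ Y) (qX : X ∈ ({A, B, C, D, E, G, F} : Set α))
    (qY : Y ∈ ({A, B, C, D, E, G, F} : Set α)) :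
    (A ∈ Q ∧ (B ∈ Q ∨ C ∈ Q ∨ D ∈ Q ∨ E ∈ Q ∨ F ∈ Q ∨ G ∈ Q)) ∨
      (B ∈ Q ∧ (C ∈ Q ∨ D ∈ Q ∨ E ∈ Q ∨ F ∈ Q ∨ G ∈ Q)) ∨
      (C ∈ Q ∧ (D ∈ Q ∨ E ∈ Q ∨ F ∈ Q ∨ G ∈ Q)) ∨ (D ∈ Q ∧ (E ∈ Q ∨ F ∈ Q ∨ G ∈ Q)) ∨
      (E ∈ Q ∧ (F ∈ Q ∨ G ∈ Q)) ∨ (F ∈ Q ∧ G ∈ Q) := by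
  rcases qX with rfl | rfl | rfl | rfl | rfl | rfl | rfl <;>
    rcases qY with rfl | rfl | rfl | rfl | rfl | rfl | rfl <;>
    first | exact absurd rfl hXY | simp only [hX, hY, true_and, true_or, or_true]

namespace SpiralCoords

variable {ℓ x₁ x₂ x₃ y₁ y₂ y₃ : ℝ}

theorem sUnion_eq (h : SpiralCoords ℓ x₁ x₂ x₃ y₁ y₂ y₃) :
    ⋃₀ spiralTiles ℓ x₁ x₂ x₃ y₁ y₂ y₃ = box 0 ℓ 0 ℓ := by
  obtain ⟨a1, a2, a3, a4, a5, a6, a7, a8, -⟩ := h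
  ext p
  simp only [spiralTiles, sUnion_insert, sUnion_singleton, mem_union, mem_box]
  constructor
  · rintro (h | h | h | h | h | h | h) <;> obtain ⟨⟨h1, h2⟩, h3, h4⟩ := h <;>
      exact ⟨⟨by linarith, by linarith⟩, by linarith, by linarith⟩
  · rintro ⟨⟨h1, h2⟩, h3, h4⟩
    rcases le_total x₃ (p 0) with u | u
    · rcases le_total y₁ (p 1) with v | v
      · exact Or.inr (Or.inl ⟨⟨u, h2⟩, v, h4⟩)
      · exact Or.inr (Or.inr (Or.inl ⟨⟨by linarith, h2⟩, h3, v⟩))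
    rcases le_total y₃ (p 1) with v | v
    · exact Or.inl ⟨⟨h1, u⟩, v, h4⟩
    rcases le_total (p 1) y₁ with w | w
    · rcases le_total (p 0) x₁ with t | t
      · exact Or.inr (Or.inr (Or.inr (Or.inl ⟨⟨h1, t⟩, h3, by linarith⟩)))
      · exact Or.inr (Or.inr (Or.inl ⟨⟨t, h2⟩, h3, w⟩))
    rcases le_total x₂ (p 0) with t | t
    · exact Or.inr (Or.inr (Or.inr (Or.inr (Or.inr (Or.inl ⟨⟨t, u⟩, w, v⟩)))))
    rcases le_total y₂ (p 1) with s | s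
    · exact Or.inr (Or.inr (Or.inr (Or.inr (Or.inl ⟨⟨h1, t⟩, s, v⟩))))
    rcases le_total (p 0) x₁ with r | r
    · exact Or.inr (Or.inr (Or.inr (Or.inl ⟨⟨h1, r⟩, h3, s⟩)))
    · exact Or.inr (Or.inr (Or.inr (Or.inr (Or.inr (Or.inr ⟨⟨r, t⟩, w, s⟩)))))

theorem isRectangle (h : SpiralCoords ℓ x₁ x₂ x₃ y₁ y₂ y₃) :
    ∀ A ∈ spiralTiles ℓ x₁ x₂ x₃ y₁ y₂ y₃, IsRectangle A := by
  obtain ⟨a1, a2, a3, a4, a5, a6, a7, a8, -⟩ := h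
  rintro A (rfl | rfl | rfl | rfl | rfl | rfl | rfl) <;>
    exact ⟨_, _, hasSides_box (by linarith) (by linarith)⟩

theorem disjoint (h : SpiralCoords ℓ x₁ x₂ x₃ y₁ y₂ y₃) :
    (spiralTiles ℓ x₁ x₂ x₃ y₁ y₂ y₃).Pairwise
      fun A B => Disjoint (interior A) (interior B) := by
  obtain ⟨a1, a2, a3, a4, a5, a6, a7, a8, -⟩ := h
  rintro A (rfl | rfl | rfl | rfl | rfl | rfl | rfl) B (rfl | rfl | rfl | rfl | rfl | rfl | rfl) hAB
  all_goals first
    | exact absurd rfl hAB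
    | (rw [interior_box, interior_box, disjoint_left]
       rintro p ⟨⟨p1, p2⟩, p3, p4⟩ ⟨⟨q1, q2⟩, q3, q4⟩
       linarith)

theorem isPerfect (h : SpiralCoords ℓ x₁ x₂ x₃ y₁ y₂ y₃) :
    IsPerfect 7 (box 0 ℓ 0 ℓ) (spiralTiles ℓ x₁ x₂ x₃ y₁ y₂ y₃) := by
  obtain ⟨a1, a2, a3, a4, a5, a6, a7, a8, A, B, C, D, E, F, G⟩ := h
  have key {u₀ u₁ v₀ v₁ : ℝ} (hu : u₀ < u₁) (ha : (u₁ - u₀) * (v₁ - v₀) = ℓ ^ 2 / 7) :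
      volume (box u₀ u₁ v₀ v₁) = volume (box 0 ℓ 0 ℓ) / ((7 : ℕ) : ENNReal) := by
    rw [volume_box, volume_box, sub_zero, ← ENNReal.ofReal_mul (by linarith),
      ← ENNReal.ofReal_mul (by linarith), show ((7 : ℕ) : ENNReal) = ENNReal.ofReal 7 by simp,
      ← ENNReal.ofReal_div_of_pos (by norm_num), ha, sq]
  rintro X (rfl | rfl | rfl | rfl | rfl | rfl | rfl)
  all_goals exact key (by linarith) (by simpa only [sub_zero])

end SpiralCoords

/-- With bounds on the coordinates, membership of points with decimal coordinates, in units of `ℓ`,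
becomes a numerical check in a smaller box. -/
theorem box_inner {ℓ x₀ x₁ y₀ y₁ a b c d : ℝ} (hℓ : 0 < ℓ) (h1 : x₀ ≤ a * ℓ) (h2 : b * ℓ ≤ x₁)
    (h3 : y₀ ≤ c * ℓ) (h4 : d * ℓ ≤ y₁) :
    (∀ p q, (a ≤ p ∧ p ≤ b) ∧ c ≤ q ∧ q ≤ d →
      (!₂[p * ℓ, q * ℓ] : Plane) ∈ box x₀ x₁ y₀ y₁) ∧
    (∀ p q, (a < p ∧ p < b) ∧ c < q ∧ q < d →
      (!₂[p * ℓ, q * ℓ] : Plane) ∈ interior (box x₀ x₁ y₀ y₁)) := by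
  constructor
  · rintro p q ⟨⟨p1, p2⟩, q1, q2⟩
    exact ⟨⟨h1.trans (mul_le_mul_of_nonneg_right p1 hℓ.le),
      (mul_le_mul_of_nonneg_right p2 hℓ.le).trans h2⟩,
      h3.trans (mul_le_mul_of_nonneg_right q1 hℓ.le),
      (mul_le_mul_of_nonneg_right q2 hℓ.le).trans h4⟩
  · rintro p q ⟨⟨p1, p2⟩, q1, q2⟩
    rw [interior_box]
    exact ⟨⟨h1.trans_lt (mul_lt_mul_of_pos_right p1 hℓ),
      (mul_lt_mul_of_pos_right p2 hℓ).trans_le h2⟩,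
      h3.trans_lt (mul_lt_mul_of_pos_right q1 hℓ),
      (mul_lt_mul_of_pos_right q2 hℓ).trans_le h4⟩

/-- Numerical bounds for the coordinates of the perfect spiral. -/
structure SpiralBounds (ℓ x₁ x₂ x₃ y₁ y₂ y₃ : ℝ) : Prop where
  ℓ_pos : 0 < ℓ
  x₁_gt : 0.2427 * ℓ < x₁
  x₁_lt : x₁ < 0.2428 * ℓ
  x₂_eq : x₂ = 0.6 * ℓ
  x₃_gt : 0.8239 * ℓ < x₃
  x₃_lt : x₃ < 0.8240 * ℓ
  y₁_gt : 0.1886 * ℓ < y₁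
  y₁_lt : y₁ < 0.1887 * ℓ
  y₂_gt : 0.5885 * ℓ < y₂
  y₂_lt : y₂ < 0.5886 * ℓ
  y₃_gt : 0.8266 * ℓ < y₃
  y₃_lt : y₃ < 0.8267 * ℓ

namespace SpiralBounds

variable {ℓ x₁ x₂ x₃ y₁ y₂ y₃ : ℝ}

/-- The tiles, ordered by diameter. -/
theorem diam_lt (h : SpiralBounds ℓ x₁ x₂ x₃ y₁ y₂ y₃) :
      Metric.diam (box x₁ x₂ y₁ y₂) ^ 2 < Metric.diam (box 0 x₁ 0 y₂) ^ 2 ∧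
      Metric.diam (box 0 x₁ 0 y₂) ^ 2 < Metric.diam (box 0 x₂ y₂ y₃) ^ 2 ∧
      Metric.diam (box 0 x₂ y₂ y₃) ^ 2 < Metric.diam (box x₂ x₃ y₁ y₃) ^ 2 ∧
      Metric.diam (box x₂ x₃ y₁ y₃) ^ 2 < Metric.diam (box x₁ ℓ 0 y₁) ^ 2 ∧
      Metric.diam (box x₁ ℓ 0 y₁) ^ 2 < Metric.diam (box x₃ ℓ y₁ ℓ) ^ 2 ∧
      Metric.diam (box x₃ ℓ y₁ ℓ) ^ 2 < Metric.diam (box 0 x₃ y₃ ℓ) ^ 2 := by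
  obtain ⟨a0, a1, a2, a3, a4, a5, a6, a7, a8, a9, a10, a11⟩ := h
  -- Here `a`, `b` enclose the width and `c`, `d` the height, in units of `ℓ`. The resulting
  -- intervals for the squared diameters are disjoint.
  obtain ⟨lA, uA⟩ := diam_box_bounds (x₀ := 0) (x₁ := x₃) (y₀ := y₃) (y₁ := ℓ)
    (a := 0.8239) (b := 0.8241) (c := 0.1733) (d := 0.1735) a0 (by norm_num) (by norm_num)
    (by linarith) (by linarith) (by linarith) (by linarith)
  obtain ⟨lB, uB⟩ := diam_box_bounds (x₀ := x₃) (x₁ := ℓ) (y₀ := y₁) (y₁ := ℓ)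
    (a := 0.176) (b := 0.1762) (c := 0.8113) (d := 0.8115) a0 (by norm_num) (by norm_num)
    (by linarith) (by linarith) (by linarith) (by linarith)
  obtain ⟨lC, uC⟩ := diam_box_bounds (x₀ := x₁) (x₁ := ℓ) (y₀ := 0) (y₁ := y₁)
    (a := 0.7572) (b := 0.7574) (c := 0.1886) (d := 0.1888) a0 (by norm_num) (by norm_num)
    (by linarith) (by linarith) (by linarith) (by linarith)
  obtain ⟨lD, uD⟩ := diam_box_bounds (x₀ := 0) (x₁ := x₁) (y₀ := 0) (y₁ := y₂)
    (a := 0.2427) (b := 0.2429) (c := 0.5885) (d := 0.5887) a0 (by norm_num) (by norm_num)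
    (by linarith) (by linarith) (by linarith) (by linarith)
  obtain ⟨lE, uE⟩ := diam_box_bounds (x₀ := 0) (x₁ := x₂) (y₀ := y₂) (y₁ := y₃)
    (a := 0.6) (b := 0.6002) (c := 0.238) (d := 0.2382) a0 (by norm_num) (by norm_num)
    (by linarith) (by linarith) (by linarith) (by linarith)
  obtain ⟨lG, uG⟩ := diam_box_bounds (x₀ := x₂) (x₁ := x₃) (y₀ := y₁) (y₁ := y₃)
    (a := 0.2239) (b := 0.2241) (c := 0.6379) (d := 0.6381) a0 (by norm_num) (by norm_num)
    (by linarith) (by linarith) (by linarith) (by linarith)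
  obtain ⟨lF, uF⟩ := diam_box_bounds (x₀ := x₁) (x₁ := x₂) (y₀ := y₁) (y₁ := y₂)
    (a := 0.3572) (b := 0.3574) (c := 0.3998) (d := 0.4000) a0 (by norm_num) (by norm_num)
    (by linarith) (by linarith) (by linarith) (by linarith)
  have hsq : 0 < ℓ ^ 2 := by positivity
  refine ⟨?_, ?_, ?_, ?_, ?_, ?_⟩
  · linarith only [hsq, uF, lD]
  · linarith only [hsq, uD, lE]
  · linarith only [hsq, uE, lG]
  · linarith only [hsq, uG, lC]
  · linarith only [hsq, uC, lB]
  · linarith only [hsq, uB, lA]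

theorem eq_of_diam_eq (h : SpiralBounds ℓ x₁ x₂ x₃ y₁ y₂ y₃) :
    ∀ A ∈ spiralTiles ℓ x₁ x₂ x₃ y₁ y₂ y₃, ∀ B ∈ spiralTiles ℓ x₁ x₂ x₃ y₁ y₂ y₃,
      Metric.diam A ^ 2 = Metric.diam B ^ 2 → A = B := by
  obtain ⟨o1, o2, o3, o4, o5, o6⟩ := h.diam_lt
  clear h
  rintro A (rfl | rfl | rfl | rfl | rfl | rfl | rfl) B (rfl | rfl | rfl | rfl | rfl | rfl | rfl) hAB
  all_goals first
    | rfl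
    | (exfalso; linarith)

theorem ncard_eq (h : SpiralBounds ℓ x₁ x₂ x₃ y₁ y₂ y₃) :
    (spiralTiles ℓ x₁ x₂ x₃ y₁ y₂ y₃).ncard = 7 := by
  have key {A B C D E F G : Set Plane} {d : Set Plane → ℝ} (h : d F < d D ∧ d D < d E ∧
      d E < d G ∧ d G < d C ∧ d C < d B ∧ d B < d A) :
      ({A, B, C, D, E, G, F} : Set (Set Plane)).ncard = 7 := by
    obtain ⟨o1, o2, o3, o4, o5, o6⟩ := h
    rw [ncard_insert_of_notMem, ncard_insert_of_notMem, ncard_insert_of_notMem,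
      ncard_insert_of_notMem, ncard_insert_of_notMem, ncard_insert_of_notMem, ncard_singleton]
    · rintro rfl; linarith
    · rintro (rfl | rfl) <;> linarith
    · rintro (rfl | rfl | rfl) <;> linarith
    · rintro (rfl | rfl | rfl | rfl) <;> linarith
    · rintro (rfl | rfl | rfl | rfl | rfl) <;> linarith
    · rintro (rfl | rfl | rfl | rfl | rfl | rfl) <;> linarith
  exact key (d := fun A => Metric.diam A ^ 2) h.diam_lt

/-- If the tiles of `Q` form a rectangle, `Q` is closed under the midpoint rule `rule`. Each of the
21 pairs of tiles yields a third one, and these implications lead from any two tiles to all seven.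
-/
theorem isProper (h : SpiralBounds ℓ x₁ x₂ x₃ y₁ y₂ y₃)
    (hP : IsPartition 7 (box 0 ℓ 0 ℓ) (spiralTiles ℓ x₁ x₂ x₃ y₁ y₂ y₃)) :
    IsProper 7 (spiralTiles ℓ x₁ x₂ x₃ y₁ y₂ y₃) := by
  obtain ⟨a0, a1, a2, a3, a4, a5, a6, a7, a8, a9, a10, a11⟩ := h
  intro Q hQ h1 h7 hR
  have hQfin : Q.Finite := hP.finite.subset hQ
  obtain ⟨X, Y, hX, hY, hXY⟩ := (one_lt_ncard_iff hQfin).1 h1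
  have rule {p q p' q' : ℝ} {A B C : Set Plane} (hCP : C ∈ spiralTiles ℓ x₁ x₂ x₃ y₁ y₂ y₃)
      (i : (!₂[p * ℓ, q * ℓ] : Plane) ∈ A) (j : (!₂[p' * ℓ, q' * ℓ] : Plane) ∈ B)
      (k : (!₂[(p + p') / 2 * ℓ, (q + q') / 2 * ℓ] : Plane) ∈ interior C)
      (hAQ : A ∈ Q) (hBQ : B ∈ Q) : C ∈ Q := by
    refine hP.mem_of_midpoint hQ hR hAQ hBQ hCP i j ?_
    have e : midpoint ℝ (!₂[p * ℓ, q * ℓ] : Plane) !₂[p' * ℓ, q' * ℓ] =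
        !₂[(p + p') / 2 * ℓ, (q + q') / 2 * ℓ] := by
      rw [midpoint_eq_smul_add]
      ext i
      fin_cases i <;> simp <;> ring
    rw [e]
    exact k
  have tA := box_inner (x₀ := 0) (x₁ := x₃) (y₀ := y₃) (y₁ := ℓ) (a := 0) (b := 0.8239)
    (c := 0.8267) (d := 1) a0 (by linarith)
    (by linarith) (by linarith) (by linarith)
  have tB := box_inner (x₀ := x₃) (x₁ := ℓ) (y₀ := y₁) (y₁ := ℓ) (a := 0.8240) (b := 1)
    (c := 0.1887) (d := 1) a0 (by linarith)
    (by linarith) (by linarith) (by linarith)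
  have tC := box_inner (x₀ := x₁) (x₁ := ℓ) (y₀ := 0) (y₁ := y₁) (a := 0.2428) (b := 1)
    (c := 0) (d := 0.1886) a0 (by linarith)
    (by linarith) (by linarith) (by linarith)
  have tD := box_inner (x₀ := 0) (x₁ := x₁) (y₀ := 0) (y₁ := y₂) (a := 0) (b := 0.2427)
    (c := 0) (d := 0.5885) a0 (by linarith)
    (by linarith) (by linarith) (by linarith)
  have tE := box_inner (x₀ := 0) (x₁ := x₂) (y₀ := y₂) (y₁ := y₃) (a := 0) (b := 0.6)
    (c := 0.5886) (d := 0.8266) a0 (by linarith)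
    (by linarith) (by linarith) (by linarith)
  have tF := box_inner (x₀ := x₁) (x₁ := x₂) (y₀ := y₁) (y₁ := y₂) (a := 0.2428) (b := 0.6)
    (c := 0.1887) (d := 0.5885) a0 (by linarith)
    (by linarith) (by linarith) (by linarith)
  have tG := box_inner (x₀ := x₂) (x₁ := x₃) (y₀ := y₁) (y₁ := y₃) (a := 0.6) (b := 0.8239)
    (c := 0.1887) (d := 0.8266) a0 (by linarith)
    (by linarith) (by linarith) (by linarith)
  have hsub : spiralTiles ℓ x₁ x₂ x₃ y₁ y₂ y₃ ⊆ Q := by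
    unfold spiralTiles at *
    obtain ⟨A, hA⟩ : ∃ A, A = box 0 x₃ y₃ ℓ := ⟨_, rfl⟩
    obtain ⟨B, hB⟩ : ∃ B, B = box x₃ ℓ y₁ ℓ := ⟨_, rfl⟩
    obtain ⟨C, hC⟩ : ∃ C, C = box x₁ ℓ 0 y₁ := ⟨_, rfl⟩
    obtain ⟨D, hD⟩ : ∃ D, D = box 0 x₁ 0 y₂ := ⟨_, rfl⟩
    obtain ⟨E, hE⟩ : ∃ E, E = box 0 x₂ y₂ y₃ := ⟨_, rfl⟩
    obtain ⟨G, hG⟩ : ∃ G, G = box x₂ x₃ y₁ y₃ := ⟨_, rfl⟩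
    obtain ⟨F, hF⟩ : ∃ F, F = box x₁ x₂ y₁ y₂ := ⟨_, rfl⟩
    rw [← hA, ← hB, ← hC, ← hD, ← hE, ← hG, ← hF] at hQ rule ⊢
    rw [← hA] at tA
    rw [← hB] at tB
    rw [← hC] at tC
    rw [← hD] at tD
    rw [← hE] at tE
    rw [← hF] at tF
    rw [← hG] at tG

    have pA : A ∈ ({A, B, C, D, E, G, F} : Set (Set Plane)) := by simp
    have pB : B ∈ ({A, B, C, D, E, G, F} : Set (Set Plane)) := by simp
    have pC : C ∈ ({A, B, C, D, E, G, F} : Set (Set Plane)) := by simp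
    have pD : D ∈ ({A, B, C, D, E, G, F} : Set (Set Plane)) := by simp
    have pE : E ∈ ({A, B, C, D, E, G, F} : Set (Set Plane)) := by simp
    have pF : F ∈ ({A, B, C, D, E, G, F} : Set (Set Plane)) := by simp
    have pG : G ∈ ({A, B, C, D, E, G, F} : Set (Set Plane)) := by simp
    -- Each line exhibits points of two tiles whose midpoint is interior to a third. The points are
    -- away from the tile boundaries by more than the uncertainty of the coordinates, or on the
    -- boundary of the square.
    have rAB := rule pF (tA.1 0.12 0.84 (by norm_num)) (tB.1 0.94 0.2 (by norm_num)) (tF.2 _ _ (by norm_num))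
    have rAC := rule pD (tA.1 0 0.94 (by norm_num)) (tC.1 0.26 0.01 (by norm_num)) (tD.2 _ _ (by norm_num))
    have rAD := rule pF (tA.1 0.71 0.84 (by norm_num)) (tD.1 0.14 0 (by norm_num)) (tF.2 _ _ (by norm_num))
    have rAE := rule pG (tA.1 0.81 0.86 (by norm_num)) (tE.1 0.57 0.6 (by norm_num)) (tG.2 _ _ (by norm_num))
    have rAF := rule pD (tA.1 0.05 0.84 (by norm_num)) (tF.1 0.25 0.2 (by norm_num)) (tD.2 _ _ (by norm_num))
    have rAG := rule pF (tA.1 0.28 0.84 (by norm_num)) (tG.1 0.78 0.2 (by norm_num)) (tF.2 _ _ (by norm_num))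
    have rBC := rule pG (tB.1 0.93 0.96 (by norm_num)) (tC.1 0.49 0.11 (by norm_num)) (tG.2 _ _ (by norm_num))
    have rBD := rule pE (tB.1 0.89 0.87 (by norm_num)) (tD.1 0.03 0.55 (by norm_num)) (tE.2 _ _ (by norm_num))
    have rBE := rule pF (tB.1 0.83 0.22 (by norm_num)) (tE.1 0.01 0.61 (by norm_num)) (tF.2 _ _ (by norm_num))
    have rBF := rule pE (tB.1 0.83 0.86 (by norm_num)) (tF.1 0.25 0.5 (by norm_num)) (tE.2 _ _ (by norm_num))
    have rBG := rule pA (tB.1 0.84 0.98 (by norm_num)) (tG.1 0.66 0.82 (by norm_num)) (tA.2 _ _ (by norm_num))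
    have rCD := rule pG (tC.1 1 0.09 (by norm_num)) (tD.1 0.23 0.36 (by norm_num)) (tG.2 _ _ (by norm_num))
    have rCE := rule pF (tC.1 0.53 0.11 (by norm_num)) (tE.1 0.31 0.71 (by norm_num)) (tF.2 _ _ (by norm_num))
    have rCF := rule pG (tC.1 0.9 0.18 (by norm_num)) (tF.1 0.52 0.52 (by norm_num)) (tG.2 _ _ (by norm_num))
    have rCG := rule pB (tC.1 1 0.03 (by norm_num)) (tG.1 0.81 0.67 (by norm_num)) (tB.2 _ _ (by norm_num))
    have rDE := rule pF (tD.1 0.23 0.21 (by norm_num)) (tE.1 0.59 0.64 (by norm_num)) (tF.2 _ _ (by norm_num))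
    have rDF := rule pC (tD.1 0.18 0 (by norm_num)) (tF.1 0.53 0.2 (by norm_num)) (tC.2 _ _ (by norm_num))
    have rDG := rule pF (tD.1 0.04 0.53 (by norm_num)) (tG.1 0.8 0.24 (by norm_num)) (tF.2 _ _ (by norm_num))
    have rEF := rule pD (tE.1 0 0.6 (by norm_num)) (tF.1 0.25 0.24 (by norm_num)) (tD.2 _ _ (by norm_num))
    have rEG := rule pF (tE.1 0.03 0.62 (by norm_num)) (tG.1 0.81 0.2 (by norm_num)) (tF.2 _ _ (by norm_num))
    have rFG := rule pE (tF.1 0.28 0.58 (by norm_num)) (tG.1 0.69 0.82 (by norm_num)) (tE.2 _ _ (by norm_num))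
    obtain ⟨qA, qB, qC, qD, qE, qF, qG⟩ := all_of_two rAB rAC rAD rAE rAF rAG rBC rBD rBE rBF rBG rCD rCE rCF rCG rDE rDF rDG rEF rEG rFG
      (two_of_mem hX hY hXY (hQ hX) (hQ hY))
    rintro X (rfl | rfl | rfl | rfl | rfl | rfl | rfl) <;> assumption
  have := ncard_le_ncard hsub hQfin
  rw [hP.ncard_eq] at this
  omega

end SpiralBounds
theorem SpiralBounds.isProperPerfectMondrian {ℓ x₁ x₂ x₃ y₁ y₂ y₃ : ℝ}
    (h : SpiralBounds ℓ x₁ x₂ x₃ y₁ y₂ y₃) (h' : SpiralCoords ℓ x₁ x₂ x₃ y₁ y₂ y₃) :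
    IsProperPerfectMondrian 7 (box 0 ℓ 0 ℓ) (spiralTiles ℓ x₁ x₂ x₃ y₁ y₂ y₃) := by
  have hP : IsPartition 7 (box 0 ℓ 0 ℓ) (spiralTiles ℓ x₁ x₂ x₃ y₁ y₂ y₃) :=
    ⟨by norm_num, by simp [spiralTiles], h.ncard_eq, h'.isRectangle, h'.disjoint, h'.sUnion_eq⟩
  exact ⟨hP, fun A hA B hB hAB hc => hAB (h.eq_of_diam_eq A hA B hB hc.diam_eq), h'.isPerfect,
    h.isProper hP⟩

/-! ### Explicit coordinates and the main theorem -/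

/-- The coordinates of the perfect spiral. -/
theorem exists_spiralCoords {ℓ : ℝ} (hℓ : 0 < ℓ) : ∃ x₁ x₂ x₃ y₁ y₂ y₃,
    SpiralCoords ℓ x₁ x₂ x₃ y₁ y₂ y₃ ∧ SpiralBounds ℓ x₁ x₂ x₃ y₁ y₂ y₃ := by
  obtain ⟨r, hr, hr2⟩ : ∃ r : ℝ, 0 ≤ r ∧ r ^ 2 = 19 :=
    ⟨√19, Real.sqrt_nonneg _, Real.sq_sqrt (by norm_num)⟩
  have r1 : 4.3588 < r := by nlinarith
  have r2 : r < 4.3589 := by nlinarith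
  -- The solution of the area equations. Each equation is a multiple of `r ^ 2 = 19`, except that of
  -- the left tile, which is the rational identity 3/5 · 5/21 = 1/7.
  have hb : SpiralBounds ℓ ((8 - r) / 15 * ℓ) (0.6 * ℓ) ((8 + r) / 15 * ℓ) ((7 - r) / 14 * ℓ)
      ((8 + r) / 21 * ℓ) ((13 + r) / 21 * ℓ) := by
    refine ⟨hℓ, ?_, ?_, rfl, ?_, ?_, ?_, ?_, ?_, ?_, ?_, ?_⟩
    all_goals
      apply mul_lt_mul_of_pos_right _ hℓ
      linarith
  have ⟨a0, a1, a2, a3, a4, a5, a6, a7, a8, a9, a10, a11⟩ := hb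
  refine ⟨_, _, _, _, _, _, ⟨?_, ?_, ?_, ?_, ?_, ?_, ?_, ?_, ?_, ?_, ?_, ?_, ?_, ?_, ?_⟩, hb⟩
  iterate 8 linarith
  · linear_combination (-ℓ ^ 2 / 315) * hr2
  · linear_combination (-ℓ ^ 2 / 210) * hr2
  · linear_combination (-ℓ ^ 2 / 210) * hr2
  · linear_combination (-ℓ ^ 2 / 315) * hr2
  · ring
  · linear_combination (ℓ ^ 2 / 126) * hr2
  · linear_combination (ℓ ^ 2 / 126) * hr2

theorem area_eq_of_volume_eq {f : Plane ≃ᵢ Plane} {ℓ x₀ x₁ y₀ y₁ : ℝ} (hℓ : 0 < ℓ)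
    (hx : x₀ < x₁) (hy : y₀ < y₁)
    (h : volume (f '' box x₀ x₁ y₀ y₁) = volume (f '' box 0 ℓ 0 ℓ) / ((7 : ℕ) : ENNReal)) :
    (x₁ - x₀) * (y₁ - y₀) = ℓ ^ 2 / 7 := by
  rw [volume_image, volume_image, volume_box, volume_box, sub_zero,
    ← ENNReal.ofReal_mul (sub_nonneg.2 hx.le), ← ENNReal.ofReal_mul hℓ.le,
    show ((7 : ℕ) : ENNReal) = ENNReal.ofReal 7 by simp,
    ← ENNReal.ofReal_div_of_pos (by norm_num),
    ENNReal.ofReal_eq_ofReal_iff (mul_nonneg (sub_nonneg.2 hx.le) (sub_nonneg.2 hy.le))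
      (by positivity)] at h
  rw [h, sq]

theorem spiralCoords_of_isPerfect {f : Plane ≃ᵢ Plane} {ℓ x₁ x₂ x₃ y₁ y₂ y₃ : ℝ}
    (h1 : 0 < x₁) (h2 : x₁ < x₂) (h3 : x₂ < x₃) (h4 : x₃ < ℓ) (h5 : 0 < y₁) (h6 : y₁ < y₂)
    (h7 : y₂ < y₃) (h8 : y₃ < ℓ) (h : IsPerfect 7 (f '' box 0 ℓ 0 ℓ)
      (mapPartition f (spiralTiles ℓ x₁ x₂ x₃ y₁ y₂ y₃))) : SpiralCoords ℓ x₁ x₂ x₃ y₁ y₂ y₃ := by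
  have key {u₀ u₁ v₀ v₁ : ℝ} (hu : u₀ < u₁) (hv : v₀ < v₁)
      (hm : box u₀ u₁ v₀ v₁ ∈ spiralTiles ℓ x₁ x₂ x₃ y₁ y₂ y₃) :
      (u₁ - u₀) * (v₁ - v₀) = ℓ ^ 2 / 7 :=
    area_eq_of_volume_eq (by linarith) hu hv (h _ ⟨_, hm, rfl⟩)
  refine ⟨h1, h2, h3, h4, h5, h6, h7, h8, ?_, ?_, ?_, ?_, ?_, ?_, ?_⟩
  · simpa using key (u₀ := 0) (u₁ := x₃) (v₀ := y₃) (v₁ := ℓ) (by linarith) h8 (by simp [spiralTiles])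
  · exact key h4 (by linarith) (by simp [spiralTiles])
  · simpa using key (u₀ := x₁) (u₁ := ℓ) (v₀ := 0) (v₁ := y₁) (by linarith) h5 (by simp [spiralTiles])
  · simpa using key (u₀ := 0) (u₁ := x₁) (v₀ := 0) (v₁ := y₂) h1 (by linarith) (by simp [spiralTiles])
  · simpa using key (u₀ := 0) (u₁ := x₂) (v₀ := y₂) (v₁ := y₃) (by linarith) h7 (by simp [spiralTiles])
  · exact key h2 h6 (by simp [spiralTiles])
  · exact key h3 (by linarith) (by simp [spiralTiles])

end Mondrian

theorem mainTheorem3 (S : Set Mondrian.Plane) (hS : Mondrian.IsSquareSet S) :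
    ∃ P : Set (Set Mondrian.Plane),
      Mondrian.IsProperPerfectMondrian 7 S P ∧ Mondrian.IsSpiral S P ∧
      ∀ P' : Set (Set Mondrian.Plane), Mondrian.IsProperPerfectMondrian 7 S P' →
        ∃ e : Mondrian.Plane ≃ᵢ Mondrian.Plane,
          e '' S = S ∧ P' = Mondrian.mapPartition e P := by
  have hS' := hS
  obtain ⟨ℓ, hsides⟩ := hS
  have ⟨hℓ, _, f, hf⟩ := hsides
  obtain ⟨x₁, x₂, x₃, y₁, y₂, y₃, hc, hb⟩ := Mondrian.exists_spiralCoords hℓ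
  refine ⟨Mondrian.mapPartition f (Mondrian.spiralTiles ℓ x₁ x₂ x₃ y₁ y₂ y₃), ?_, ?_, ?_⟩
  · rw [hf]
    exact (hb.isProperPerfectMondrian hc).image f
  · exact ⟨f, ℓ, x₁, x₂, x₃, y₁, y₂, y₃, hc.x₁_pos, hc.x₁_lt, hc.x₂_lt, hc.x₃_lt, hc.y₁_pos,
      hc.y₁_lt, hc.y₂_lt, hc.y₃_lt, hf, rfl⟩
  · intro P' hP'
    obtain ⟨g, ℓ', x₁', x₂', x₃', y₁', y₂', y₃', h1, h2, h3, h4, h5, h6, h7, h8, hg, rfl⟩ :=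
      hP'.isSpiral hS'
    have hℓ' : 0 < ℓ' := by linarith
    have hsides' : Mondrian.HasSides S ℓ' ℓ' := ⟨hℓ', hℓ', g, hg⟩
    -- The diameter of `S` determines its side.
    have e : ℓ' ^ 2 = ℓ ^ 2 := by linarith [hsides.diam_sq, hsides'.diam_sq]
    obtain rfl : ℓ' = ℓ := (pow_left_inj₀ hℓ'.le hℓ.le two_ne_zero).1 e
    have hperf := hP'.isPerfect
    rw [hg] at hperf
    obtain ⟨rfl, rfl, rfl, rfl, rfl, rfl⟩ :=
      hc.unique (Mondrian.spiralCoords_of_isPerfect h1 h2 h3 h4 h5 h6 h7 h8 hperf)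
    -- Both `f` and `g` carry the same spiral in the same standard square to `S`, so going back by
    -- `f` and forward by `g` is the required symmetry.
    refine ⟨f.symm.trans g, ?_, ?_⟩
    · conv_lhs => rw [hf]
      rw [Set.image_image, hg]
      simp
    · rw [Mondrian.mapPartition_trans]
      congr 1
      ext1 p
      simp
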